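/- **Setting.** A weighted species $\mathcal F^\omega$ assigns to each finite set $U$ a finite set $\mathcal F[U]$ of structures of size $|U|$ with weights $\omega\colon\mathcal F[U]\to\mathbb R_{\ge 0}$, and functorially to each bijection $\sigma\colon U\to V$ a weight-preserving bijection $\mathcal F[\sigma]\colon\mathcal F[U]\to\mathcal F[V]$. Write $[n]=\{1,\dots,n\}$, $\mathcal F[n]=\mathcal F[[n]]$, $\mathscr U(\mathcal F)=\bigcup_{n\ge 0}\mathcal F[n]$ (a disjoint union) and $\mathcal F^\omega(z)=\sum_{F\in\mathscr U(\mathcal F)}\omega(F)z^{|F|}/|F|!$. If $y>0$ and $0<\mathcal F^\omega(y)<\infty$, the Boltzmann distribution $\mathbb P_{\mathcal F^\omega,y}$ on $\mathscr U(\mathcal F)$ gives $F$ the probability $\mathcal F^\omega(y)^{-1}\omega(F)y^{|F|}/|F|!$. The derived species is $\mathcal F'[U]=\mathcal F[U\cup\{*\}]$ with $*\notin U$, where $*$ is not counted in the size. For a species $\mathcal G^\nu$ with $\mathcal G[\emptyset]=\emptyset$, an $(\mathcal F\circ\mathcal G)$-structure on $U$ consists of a partition $\pi$ of $U$ into non-empty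 classes, an $\mathcal F$-structure $F$ on the set $\pi$ and a $\mathcal G$-structure $G_Q$ on each $Q\in\pi$; its weight is $\omega(F)\prod_{Q\in\pi}\nu(G_Q)$. For $n\ge 1$ with $[z^n](\mathcal F^\omega\circ\mathcal G^\nu)(z)>0$ draw $\mathsf S_n=(\mathsf F_n,(\mathsf G_Q)_{Q\in\pi_n})$ from $(\mathcal F\circ\mathcal G)[n]$ with probability proportional to its weight, and choose $Q_0$ uniformly at random among the classes of $\pi_n$ of maximal size. Relabelling the atom $Q_0$ of $\mathsf F_n$ to $*$, deleting $\mathsf G_{Q_0}$, and relabelling $[n]\setminus Q_0$ increasingly by $[n-|Q_0|]$ yields the remainder $\mathsf R_n\in\mathscr U(\mathcal F'\circ\mathcal G)$. For $d\ge 1$, a power series $g(z)=\sum_n g_nz^n$ with non-negative coefficients and radius of convergence $\rho\in(0,\infty)$ belongs to $\mathscr S_d$ if $g_n=0$ whenever $d\nmid n$, $g(\rho)<\infty$, and, as $n\to\infty$ with $n\equiv 0 \bmod d$, $$\frac{g_n}{g_{n+d}}\to\rho^d,\qquad \frac1{g_n}\sum_{i+j=n}g_ig_j\to 2g(\rho).$$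 **Theorem 3.4.** Let $\mathcal F^\omega$, $\mathcal G^\nu$ be weighted species with $\mathcal G[\emptyset]=\emptyset$. Suppose that there are integers $0\le m<d$ such that $\mathcal G^\nu(z)/z^m$ is a power series in $\mathscr S_d$ with radius of convergence $\rho$, and that $\mathcal F^\omega(z)$ has radius of convergence strictly larger than $\mathcal G^\nu(\rho)$. Let $D=d/\gcd(m,d)$, let $0\le a<D$, and let $\mathcal F_a^\omega$ be the restriction of $\mathcal F^\omega$ to objects whose size lies in $a+D\mathbb Z$. If the series $\mathcal F_a^\omega(z)$ is not constant, then $0<((\mathcal F_a')^\omega\circ\mathcal G^\nu)(\rho)<\infty$, where $\mathcal F_a'=(\mathcal F_a)'$, the remainder $\mathsf R_n$ is well defined for all sufficiently large $n\equiv am \bmod d$, and $$d_{\mathrm{TV}}(\mathsf R_n,\mathsf R(a))=\sup_{\mathcal E\subset\mathscr U(\mathcal F'\circ\mathcal G)}\bigl|\mathbb P(\mathsf R_n\in\mathcal E)-\mathbb P(\mathsf R(a)\in\mathcal E)\bigr|\to 0,\qquad n\to\infty,\quad n\equiv am \bmod d,$$ where $\mathsf R(a)$ is a random $(\mathcal F_a'\circ\mathcal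 G)$-object, regarded as an element of $\mathscr U(\mathcal F'\circ\mathcal G)$, with the Boltzmann distribution $\mathbb P_{(\mathcal F_a')^\omega\circ\mathcal G^\nu,\rho}$. -/

import Mathlib

open scoped NNReal ENNReal Topology

noncomputable section

/-- A combinatorial species with non-negative weights: a functor from finite sets with bijections
to finite sets, together with an isomorphism-invariant weight. -/
structure WeightedSpecies where
  /-- The set of structures on a finite set of labels. -/
  obj : (U : Type) → [Finite U] → Type
  finite_obj : ∀ (U : Type) [Finite U], Finite (obj U)
  /-- Transport of structures along a bijection of the labels. -/
  map : ∀ {U V : Type} [Finite U] [Finite V], U ≃ V → obj U → obj V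
  map_refl : ∀ {U : Type} [Finite U] (x : obj U), map (Equiv.refl U) x = x
  map_trans : ∀ {U V W : Type} [Finite U] [Finite V] [Finite W] (σ : U ≃ V) (τ : V ≃ W)
    (x : obj U), map (σ.trans τ) x = map τ (map σ x)
  /-- The weight of a structure. -/
  weight : ∀ {U : Type} [Finite U], obj U → ℝ≥0
  weight_map : ∀ {U V : Type} [Finite U] [Finite V] (σ : U ≃ V) (x : obj U),
    weight (map σ x) = weight x

namespace WeightedSpecies

instance (F : WeightedSpecies) (U : Type) [Finite U] : Finite (F.obj U) := F.finite_obj U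

/-- All structures on the label sets `{1, …, n}`, `n ≥ 0`. -/
abbrev Universe (F : WeightedSpecies) : Type := Σ n : ℕ, F.obj (Fin n)

/-- The exponential generating series, as a formal power series. -/
def egf (F : WeightedSpecies) : PowerSeries ℝ :=
  PowerSeries.mk fun n => (∑ᶠ x : F.obj (Fin n), (F.weight x : ℝ)) / (n.factorial : ℝ)

/-- The unnormalized Boltzmann weight `ω(F) y^{|F|} / |F|!`. -/
def boltzmannWeight (F : WeightedSpecies) (y : ℝ≥0) (x : F.Universe) : ℝ≥0∞ :=
  ((F.weight x.2 * y ^ x.1 / (x.1.factorial : ℝ≥0) : ℝ≥0) : ℝ≥0∞)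

/-- The value in `[0, ∞]` of the exponential generating series at `y ≥ 0`. -/
def value (F : WeightedSpecies) (y : ℝ≥0) : ℝ≥0∞ := ∑' x : F.Universe, F.boltzmannWeight y x

/-- The Boltzmann distribution with parameter `y`, where `0 < F(y) < ∞`. -/
def boltzmann (F : WeightedSpecies) (y : ℝ≥0) (h0 : F.value y ≠ 0) (h : F.value y ≠ ∞) :
    PMF F.Universe :=
  PMF.normalize (F.boltzmannWeight y) h0 h

/-- The restriction of a species to the structures whose size lies in `a + Dℤ`. -/
def restrict (F : WeightedSpecies) (D a : ℕ) : WeightedSpecies where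
  obj U _ := {_x : F.obj U // Nat.card U ≡ a [MOD D]}
  finite_obj _ _ := inferInstance
  map σ x := ⟨F.map σ x.1, by rw [← Nat.card_congr σ]; exact x.2⟩
  map_refl x := Subtype.ext (F.map_refl x.1)
  map_trans σ τ x := Subtype.ext (F.map_trans σ τ x.1)
  weight x := F.weight x.1
  weight_map σ x := F.weight_map σ x.1

/-- The derived species; `none` plays the role of the placeholder `*`. -/
def deriv (F : WeightedSpecies) : WeightedSpecies where
  obj U _ := F.obj (Option U)
  finite_obj _ _ := inferInstance
  map σ x := F.map σ.optionCongr x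
  map_refl x := by rw [Equiv.optionCongr_refl]; exact F.map_refl x
  map_trans σ τ x := by rw [Equiv.optionCongr_trans]; exact F.map_trans _ _ x
  weight x := F.weight x
  weight_map σ x := F.weight_map _ x

/-- Partitions of a set into non-empty classes. -/
abbrev SetPartition (U : Type) : Type := {π : Set (Set U) // Setoid.IsPartition π}

/-- The partition `{σ(Q) | Q ∈ π}`; here `P = σ(Q)` is written as `σ⁻¹(P) = Q`. -/
def SetPartition.transport {U V : Type} (σ : U ≃ V) (π : SetPartition U) : SetPartition V :=
  ⟨{P | σ ⁻¹' P ∈ π.1}, by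
    refine ⟨fun h => π.2.1 (by simpa using h), fun v => ?_⟩
    obtain ⟨Q, ⟨hQ, hv⟩, huniq⟩ := π.2.2 (σ.symm v)
    refine ⟨σ.symm ⁻¹' Q, ⟨?_, hv⟩, ?_⟩
    · change σ ⁻¹' (σ.symm ⁻¹' Q) ∈ π.1
      rw [← Set.preimage_comp]
      simpa using hQ
    · rintro P ⟨hP, hvP⟩
      have h := huniq (σ ⁻¹' P) ⟨hP, by simpa using hvP⟩
      rw [← h, ← Set.preimage_comp]
      simp⟩

/-- The bijection `Q ↦ σ(Q)` between the classes of a partition and of its transport. -/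
def SetPartition.classEquiv {U V : Type} (σ : U ≃ V) (π : SetPartition U) :
    π.1 ≃ (π.transport σ).1 where
  toFun Q := ⟨σ.symm ⁻¹' Q.1, by
    change σ ⁻¹' (σ.symm ⁻¹' Q.1) ∈ π.1
    rw [← Set.preimage_comp]
    simp⟩
  invFun P := ⟨σ ⁻¹' P.1, P.2⟩
  left_inv Q := Subtype.ext (by simp [← Set.preimage_comp])
  right_inv P := Subtype.ext (by simp [← Set.preimage_comp])

/-- The restriction of a bijection `σ` to a bijection `σ⁻¹(P) → P`. -/
def preimageEquiv {U V : Type} (σ : U ≃ V) (P : Set V) : ↥(σ ⁻¹' P) ≃ ↥P :=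
  σ.subtypeEquiv fun _ => Iff.rfl

/-- The composition `F ∘ G`: a partition, an `F`-structure on its set of classes, and a
`G`-structure on each class. -/
def comp (F G : WeightedSpecies) : WeightedSpecies where
  obj U _ := Σ π : SetPartition U, F.obj π.1 × (∀ Q : π.1, G.obj Q.1)
  finite_obj _ _ := inferInstance
  map σ S := ⟨S.1.transport σ, F.map (S.1.classEquiv σ) S.2.1,
    fun P => G.map (preimageEquiv σ P.1) (S.2.2 ⟨σ ⁻¹' P.1, P.2⟩)⟩
  map_refl S := by
    obtain ⟨π, x, y⟩ := S
    refine Sigma.ext rfl (heq_of_eq (Prod.ext ?_ (funext fun P => ?_)))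
    · exact F.map_refl x
    · exact G.map_refl _
  map_trans σ τ S := by
    obtain ⟨π, x, y⟩ := S
    refine Sigma.ext rfl (heq_of_eq (Prod.ext ?_ (funext fun P => ?_)))
    · exact F.map_trans (π.classEquiv σ) ((π.transport σ).classEquiv τ) x
    · exact G.map_trans (preimageEquiv σ (τ ⁻¹' P.1)) (preimageEquiv τ P.1) _
  weight S := F.weight S.2.1 * ∏ᶠ Q, G.weight (S.2.2 Q)
  weight_map σ S := by
    obtain ⟨π, x, y⟩ := S
    dsimp only
    rw [F.weight_map]
    congr 1
    exact finprod_eq_of_bijective (π.classEquiv σ).symm (π.classEquiv σ).symm.bijective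
      fun P => G.weight_map _ _

/-- The inclusion of the `(F_a)' ∘ G`-objects into the `F' ∘ G`-objects, where `F_a` is the
restriction of `F` to sizes in `a + Dℤ`. -/
def inclusion (F G : WeightedSpecies) (D a : ℕ)
    (R : ((F.restrict D a).deriv.comp G).Universe) : (F.deriv.comp G).Universe :=
  ⟨R.1, R.2.1, R.2.2.1.1, R.2.2.2⟩

/-- The partition of the complement of the class `Q₀` into the other classes. -/
def SetPartition.erase {U : Type} (π : SetPartition U) (Q₀ : π.1) :
    SetPartition ↥(Q₀.1ᶜ) :=
  ⟨{P | Subtype.val '' P ∈ π.1}, by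
    refine ⟨fun h => π.2.1 (by simpa using h), fun v => ?_⟩
    obtain ⟨Q, ⟨hQ, hv⟩, huniq⟩ := π.2.2 v.1
    have hne : Q ≠ Q₀.1 := fun h => v.2 (h ▸ hv)
    have hsub : Q ⊆ Q₀.1ᶜ := fun u hu hu' =>
      hne ((π.2.2 u).unique ⟨hQ, hu⟩ ⟨Q₀.2, hu'⟩)
    have himg : Subtype.val '' (Subtype.val ⁻¹' Q : Set ↥(Q₀.1ᶜ)) = Q := by
      rw [Subtype.image_preimage_coe]
      exact Set.inter_eq_right.2 hsub
    refine ⟨Subtype.val ⁻¹' Q, ⟨?_, hv⟩, ?_⟩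
    · change Subtype.val '' (Subtype.val ⁻¹' Q : Set ↥(Q₀.1ᶜ)) ∈ π.1
      rwa [himg]
    · rintro P ⟨hP, hvP⟩
      have h := huniq (Subtype.val '' P) ⟨hP, ⟨v, hvP, rfl⟩⟩
      rw [← h, Set.preimage_image_eq _ Subtype.val_injective]⟩

theorem SetPartition.image_preimage_of_ne {U : Type} (π : SetPartition U) (Q₀ Q : π.1)
    (h : Q ≠ Q₀) : Subtype.val '' (Subtype.val ⁻¹' Q.1 : Set ↥(Q₀.1ᶜ)) = Q.1 := by
  rw [Subtype.image_preimage_coe]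
  exact Set.inter_eq_right.2 fun u hu hu' =>
    h (Subtype.ext ((π.2.2 u).unique ⟨Q.2, hu⟩ ⟨Q₀.2, hu'⟩))

theorem SetPartition.image_ne {U : Type} (π : SetPartition U) (Q₀ : π.1)
    (P : Set ↥(Q₀.1ᶜ)) : Subtype.val '' P ≠ Q₀.1 := by
  intro h
  obtain ⟨u, hu⟩ : Q₀.1.Nonempty :=
    Set.nonempty_iff_ne_empty.2 fun h0 => π.2.1 (h0 ▸ Q₀.2)
  have hu' := hu
  rw [← h] at hu'
  obtain ⟨v, -, rfl⟩ := hu'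
  exact v.2 hu

open Classical in
/-- The bijection from the classes of `π` to the classes other than `Q₀` together with a
placeholder: it sends `Q₀` to the placeholder and fixes every other class. -/
def SetPartition.eraseEquiv {U : Type} (π : SetPartition U) (Q₀ : π.1) :
    π.1 ≃ Option (π.erase Q₀).1 where
  toFun Q := if h : Q = Q₀ then none else
    some ⟨Subtype.val ⁻¹' Q.1, by
      change Subtype.val '' (Subtype.val ⁻¹' Q.1 : Set ↥(Q₀.1ᶜ)) ∈ π.1
      rw [π.image_preimage_of_ne Q₀ Q h]
      exact Q.2⟩
  invFun P := P.elim Q₀ fun P => ⟨Subtype.val '' P.1, P.2⟩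
  left_inv Q := by
    by_cases h : Q = Q₀
    · simp [h]
    · simp only [h, dite_false, Option.elim_some]
      exact Subtype.ext (π.image_preimage_of_ne Q₀ Q h)
  right_inv P := by
    cases P with
    | none => simp
    | some P =>
      have h : (⟨Subtype.val '' P.1, P.2⟩ : π.1) ≠ Q₀ :=
        fun h => π.image_ne Q₀ P.1 (congrArg Subtype.val h)
      refine (dif_neg h).trans (congrArg some ?_)
      apply Subtype.ext
      exact Set.preimage_image_eq P.1 Subtype.val_injective

/-- Deleting the component `Q₀` of a composite structure. -/
def eraseComponent (F G : WeightedSpecies) {U : Type} [Finite U] (S : (F.comp G).obj U)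
    (Q₀ : S.1.1) : (F.deriv.comp G).obj ↥(Q₀.1ᶜ) :=
  ⟨S.1.erase Q₀, F.map (S.1.eraseEquiv Q₀) S.2.1, fun P =>
    G.map (Equiv.Set.image Subtype.val P.1 Subtype.val_injective).symm
      (S.2.2 ⟨Subtype.val '' P.1, P.2⟩)⟩

/-- The increasing relabelling of a subset of `{1, …, n}` with `k` elements by `{1, …, k}`. -/
def increasingRelabelling {n : ℕ} (A : Set (Fin n)) : ↥A ≃ Fin (Nat.card ↥A) :=
  letI : Fintype ↥A := Fintype.ofFinite _
  (Fintype.orderIsoFinOfCardEq ↥A Nat.card_eq_fintype_card.symm).symm.toEquiv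

/-- Deleting the component `Q₀` and relabelling the remaining labels increasingly. -/
def remainder (F G : WeightedSpecies) {n : ℕ} (S : (F.comp G).obj (Fin n)) (Q₀ : S.1.1) :
    (F.deriv.comp G).Universe :=
  ⟨Nat.card ↥(Q₀.1ᶜ),
    (F.deriv.comp G).map (increasingRelabelling (Q₀.1ᶜ)) (F.eraseComponent G S Q₀)⟩

/-- The classes of maximal size of a partition. -/
def SetPartition.largest {U : Type} [Finite U] (π : SetPartition U) : Finset π.1 :=
  (Set.toFinite {Q : π.1 | ∀ Q' : π.1, Nat.card Q'.1 ≤ Nat.card Q.1}).toFinset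

theorem SetPartition.largest_nonempty {U : Type} [Finite U] [Nonempty U] (π : SetPartition U) :
    π.largest.Nonempty := by
  obtain ⟨Q, ⟨hQ, -⟩, -⟩ := π.2.2 (Classical.arbitrary U)
  have : Nonempty π.1 := ⟨⟨Q, hQ⟩⟩
  obtain ⟨Q₀, h⟩ := Finite.exists_max fun Q : π.1 => Nat.card Q.1
  exact ⟨Q₀, by simpa [SetPartition.largest] using h⟩

theorem tsum_weight_ne_zero (F : WeightedSpecies) {n : ℕ}
    (h : 0 < PowerSeries.coeff n F.egf) :
    ∑' x : F.obj (Fin n), (F.weight x : ℝ≥0∞) ≠ 0 := by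
  intro h0
  have hx : ∀ x : F.obj (Fin n), (F.weight x : ℝ) = 0 := fun x => by
    have := ENNReal.tsum_eq_zero.1 h0 x
    simpa using this
  simp [egf, hx] at h

theorem tsum_weight_ne_top (F : WeightedSpecies) (n : ℕ) :
    ∑' x : F.obj (Fin n), (F.weight x : ℝ≥0∞) ≠ ∞ := by
  let _ : Fintype (F.obj (Fin n)) := Fintype.ofFinite _
  rw [tsum_fintype]
  exact ENNReal.sum_ne_top.2 fun x _ => ENNReal.coe_ne_top

/-- The random structure on `{1, …, n}` drawn with probability proportional to its weight. -/
def sample (F : WeightedSpecies) (n : ℕ) (h : 0 < PowerSeries.coeff n F.egf) :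
    PMF (F.obj (Fin n)) :=
  PMF.normalize (fun x => (F.weight x : ℝ≥0∞)) (F.tsum_weight_ne_zero h)
    (F.tsum_weight_ne_top n)

/-- The law of the remainder `R_n`: draw a composite structure on `{1, …, n}` with probability
proportional to its weight, choose one of its largest components uniformly at random, and
delete that component. -/
def remainderLaw (F G : WeightedSpecies) (n : ℕ) (hn : 0 < n)
    (h : 0 < PowerSeries.coeff n (F.comp G).egf) : PMF (F.deriv.comp G).Universe :=
  haveI : Nonempty (Fin n) := ⟨⟨0, hn⟩⟩
  ((F.comp G).sample n h).bind fun S =>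
    (PMF.uniformOfFinset S.1.largest S.1.largest_nonempty).map (F.remainder G S)

end WeightedSpecies

/-- The total variation distance `sup_E |P(E) - Q(E)|` of two discrete distributions. -/
def dTV {α : Type} (p q : PMF α) : ℝ :=
  ⨆ E : Set α, |(p.toOuterMeasure E).toReal - (q.toOuterMeasure E).toReal|

/-- The radius of convergence of a real power series. -/
def radiusOfConvergence (g : PowerSeries ℝ) : ℝ≥0∞ :=
  (FormalMultilinearSeries.ofScalars ℝ fun n => PowerSeries.coeff n g).radius

/-- The class `𝒮_d` of power series whose coefficients form a subexponential sequence with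
span `d`; the finite number `ρ > 0` is the radius of convergence. -/
structure IsSubexponential (d : ℕ) (ρ : ℝ≥0) (g : PowerSeries ℝ) : Prop where
  one_le : 1 ≤ d
  nonneg : ∀ n, 0 ≤ PowerSeries.coeff n g
  radius_pos : 0 < ρ
  radius_eq : radiusOfConvergence g = ρ
  support : ∀ n, ¬ d ∣ n → PowerSeries.coeff n g = 0
  ratio : Filter.Tendsto
    (fun k : ℕ => PowerSeries.coeff (d * k) g / PowerSeries.coeff (d * k + d) g)
    Filter.atTop (𝓝 ((ρ : ℝ) ^ d))
  summable : Summable fun n => PowerSeries.coeff n g * (ρ : ℝ) ^ n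
  convolution : Filter.Tendsto
    (fun k : ℕ => (∑ ij ∈ Finset.HasAntidiagonal.antidiagonal (d * k),
      PowerSeries.coeff ij.1 g * PowerSeries.coeff ij.2 g) / PowerSeries.coeff (d * k) g)
    Filter.atTop (𝓝 (2 * ∑' n, PowerSeries.coeff n g * (ρ : ℝ) ^ n))

end

/-!
A structure `S ∈ (F ∘ G)[n]` with a distinguished component `Q` is the same as its remainder, a
structure of `F' ∘ G` on `n - |Q|` points, together with a `G`-structure on `Q`. If the remainder
has size `r < n / 2`, then `Q` is the unique largest component, so the remainder law gives `R` the
mass `ω(R) / r! * g_{n-r} / [z^n] F(G(z))`. It therefore suffices to show that the last quotient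
converges to `ρ ^ r / F_a'(G(ρ))`, since by Scheffé's lemma pointwise convergence of mass functions
to a mass function implies convergence in total variation.

After rescaling by `ρ` and thinning out the lattice `m + dℕ`, the coefficients of `G` form a
subexponential density `p` with sum `P`. One big jump gives `[z^n] p^k ~ k P^(k-1) p_n`, and
Kesten's bound `[z^n] p^k ≤ C (P + ε)^k p_n` allows summing over `k` against the coefficients of
`F`. Only the `k ≡ a mod D` contribute to indices `n ≡ am mod d`, which is where `F_a` comes from.
-/

noncomputable section

open Filter PowerSeries

theorem coeff_mul_nonneg {R : Type*} [Semiring R] [PartialOrder R] [IsOrderedRing R]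
    {u v : R⟦X⟧} (hu : ∀ n, 0 ≤ coeff n u) (hv : ∀ n, 0 ≤ coeff n v) (n : ℕ) :
    0 ≤ coeff n (u * v) := by
  rw [coeff_mul]
  exact Finset.sum_nonneg fun i _ => mul_nonneg (hu _) (hv _)

theorem coeff_pow_nonneg {R : Type*} [Semiring R] [PartialOrder R] [IsOrderedRing R]
    {u : R⟦X⟧} (hu : ∀ n, 0 ≤ coeff n u) (k n : ℕ) : 0 ≤ coeff n (u ^ k) := by
  induction k generalizing n with
  | zero =>
    rw [pow_zero, coeff_one]
    split_ifs
    exacts [zero_le_one, le_rfl]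
  | succ k ih =>
    rw [pow_succ]
    exact coeff_mul_nonneg ih hu n

theorem coeff_X_pow_mul_nonneg {R : Type*} [Semiring R] [Preorder R] {u : R⟦X⟧}
    (hu : ∀ n, 0 ≤ coeff n u) (s n : ℕ) : 0 ≤ coeff n (X ^ s * u) := by
  rw [coeff_X_pow_mul']
  split_ifs
  exacts [hu _, le_rfl]

theorem hasSum_coeff_mul {u v : ℝ⟦X⟧} {U V : ℝ}
    (hu : HasSum (fun n => coeff n u) U) (hv : HasSum (fun n => coeff n v) V) :
    HasSum (fun n => coeff n (u * v)) (U * V) := by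
  have hu' : Summable fun n => ‖coeff n u‖ := hu.summable.norm
  have hv' : Summable fun n => ‖coeff n v‖ := hv.summable.norm
  have hsum := (summable_norm_sum_mul_antidiagonal_of_summable_norm hu' hv').of_norm.hasSum
  rw [← tsum_mul_tsum_eq_tsum_sum_antidiagonal_of_summable_norm hu' hv', hu.tsum_eq,
    hv.tsum_eq] at hsum
  simpa only [coeff_mul] using hsum

theorem hasSum_coeff_pow {u : ℝ⟦X⟧} {U : ℝ} (hu : HasSum (fun n => coeff n u) U) (k : ℕ) :
    HasSum (fun n => coeff n (u ^ k)) (U ^ k) := by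
  induction k with
  | zero =>
    simp only [pow_zero, coeff_one]
    exact hasSum_ite_eq 0 1
  | succ k ih =>
    rw [pow_succ, pow_succ]
    exact hasSum_coeff_mul ih hu

theorem coeff_mul_eq_sum_range_add_sum_Ico {R : Type*} [Semiring R] (u v : R⟦X⟧) {N n : ℕ}
    (hN : N ≤ n + 1) :
    coeff n (u * v) = ∑ i ∈ Finset.range N, coeff i u * coeff (n - i) v
      + ∑ i ∈ Finset.Ico N (n + 1), coeff i u * coeff (n - i) v := by
  rw [coeff_mul, Finset.Nat.sum_antidiagonal_eq_sum_range_succ_mk,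
    Finset.sum_range_add_sum_Ico _ hN]

theorem exists_forall_lt_le (f : ℕ → ℝ) (M : ℕ) : ∃ K, ∀ n < M, f n ≤ K := by
  obtain ⟨K, hK⟩ := ((Finset.range M).image f).exists_le
  exact ⟨K, fun n hn => hK _ (Finset.mem_image_of_mem f (Finset.mem_range.2 hn))⟩

theorem exists_forall_le_mul_of_eventually_le_succ {w : ℕ → ℝ} (hpos : ∀ n, 0 < w n)
    (hmono : ∀ᶠ n in atTop, w n ≤ w (n + 1)) :
    ∃ K, 0 < K ∧ ∀ t u, t ≤ u → w t ≤ K * w u := by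
  obtain ⟨M, hM⟩ := eventually_atTop.1 hmono
  have hmonoOn : MonotoneOn w (Set.Ici M) := monotoneOn_nat_Ici_of_le_succ hM
  obtain ⟨B, hB⟩ := exists_forall_lt_le w (M + 1)
  obtain ⟨B', hB'⟩ := exists_forall_lt_le (fun n => (w n)⁻¹) (M + 1)
  have hBM : ∀ i ≤ M, ∀ j ≤ M, w i ≤ B * B' * w j := fun i hi j hj => by
    have hj' : 1 ≤ B' * w j := (inv_le_iff_one_le_mul₀ (hpos j)).1 (hB' j (by lia))
    calc w i ≤ B := hB i (by lia)
      _ ≤ B * (B' * w j) := le_mul_of_one_le_right ((hpos i).le.trans (hB i (by lia))) hj'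
      _ = B * B' * w j := by ring
  have hBB' : 1 ≤ B * B' := le_of_mul_le_mul_right
    (by simpa only [one_mul] using hBM M le_rfl M le_rfl) (hpos M)
  refine ⟨B * B', one_pos.trans_le hBB', fun t u htu => ?_⟩
  rcases le_total M t with ht | ht
  · exact (hmonoOn ht (ht.trans htu) htu).trans (le_mul_of_one_le_left (hpos u).le hBB')
  rcases le_total u M with hu | hu
  · exact hBM t ht u hu
  · exact (hBM t ht M le_rfl).trans (mul_le_mul_of_nonneg_left
      (hmonoOn Set.self_mem_Ici hu hu) (zero_le_one.trans hBB'))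

theorem exists_forall_le_mul_one_add_pow {h : ℕ → ℝ} (hpos : ∀ n, 0 < h n)
    (hratio : Tendsto (fun n => h n / h (n + 1)) atTop (𝓝 1)) {ε : ℝ} (hε : 0 < ε) :
    ∃ K, 0 < K ∧ ∀ s t, s ≤ t → h (t - s) ≤ K * (1 + ε) ^ s * h t := by
  have hε1 : 0 < 1 + ε := by linarith
  have hmono : ∀ᶠ n in atTop, (1 + ε) ^ n * h n ≤ (1 + ε) ^ (n + 1) * h (n + 1) := by
    filter_upwards [hratio.eventually_lt_const (lt_add_of_pos_right 1 hε)] with n hn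
    rw [pow_succ, mul_assoc]
    exact mul_le_mul_of_nonneg_left ((div_lt_iff₀ (hpos _)).1 hn).le (by positivity)
  obtain ⟨K, hK, hle⟩ := exists_forall_le_mul_of_eventually_le_succ
    (fun n => mul_pos (pow_pos hε1 n) (hpos n)) hmono
  refine ⟨K, hK, fun s t hst => le_of_mul_le_mul_left ?_ (pow_pos hε1 (t - s))⟩
  calc (1 + ε) ^ (t - s) * h (t - s) ≤ K * ((1 + ε) ^ t * h t) := hle _ _ (Nat.sub_le t s)
    _ = (1 + ε) ^ (t - s) * (K * (1 + ε) ^ s * h t) := by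
      rw [← pow_sub_mul_pow (1 + ε) hst]; ring

/-- The span-one case of `IsSubexponential`, normalised so that the radius of convergence is `1`:
the coefficients of `p` are the point masses of a subexponential measure on `ℕ` of mass `P`. -/
structure IsSubexponentialDensity (p : ℝ⟦X⟧) (P : ℝ) : Prop where
  nonneg : ∀ n, 0 ≤ coeff n p
  hasSum : HasSum (fun n => coeff n p) P
  ratio : Tendsto (fun n => coeff n p / coeff (n + 1) p) atTop (𝓝 1)
  conv : Tendsto (fun n => coeff n (p * p) / coeff n p) atTop (𝓝 (2 * P))

/-- The coefficients of `p` with the value `0` replaced by `1`. It makes the asymptotic bounds for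
a subexponential density, whose coefficients are only eventually positive, hold at every index. -/
def posCoeff (p : ℝ⟦X⟧) (n : ℕ) : ℝ :=
  if coeff n p = 0 then 1 else coeff n p

namespace IsSubexponentialDensity

variable {p : ℝ⟦X⟧} {P : ℝ}

theorem eventually_pos (hp : IsSubexponentialDensity p P) : ∀ᶠ n in atTop, 0 < coeff n p := by
  filter_upwards [hp.ratio.eventually_const_lt zero_lt_one] with n hn
  exact (hp.nonneg n).lt_of_ne' fun h => hn.ne' (by rw [h, zero_div])

theorem sum_pos (hp : IsSubexponentialDensity p P) : 0 < P := by
  obtain ⟨n, hn⟩ := hp.eventually_pos.exists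
  exact hn.trans_le (le_hasSum hp.hasSum n fun i _ => hp.nonneg i)

theorem coeff_pow_le (hp : IsSubexponentialDensity p P) (k n : ℕ) : coeff n (p ^ k) ≤ P ^ k :=
  le_hasSum (hasSum_coeff_pow hp.hasSum k) n fun i _ => coeff_pow_nonneg hp.nonneg k i

theorem tendsto_coeff_sub_div (hp : IsSubexponentialDensity p P) (i : ℕ) :
    Tendsto (fun n => coeff (n - i) p / coeff n p) atTop (𝓝 1) := by
  rw [← tendsto_add_atTop_iff_nat i]
  simp only [Nat.add_sub_cancel]
  induction i with
  | zero =>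
    refine tendsto_const_nhds.congr' ?_
    filter_upwards [hp.eventually_pos] with n hn
    exact (div_self hn.ne').symm
  | succ i ih =>
    have h := ih.mul (hp.ratio.comp (tendsto_add_atTop_nat i))
    rw [one_mul] at h
    refine h.congr' ?_
    filter_upwards [(tendsto_add_atTop_nat i).eventually hp.eventually_pos] with n hn
    rw [Function.comp_apply, div_mul_div_cancel₀ hn.ne', add_assoc]

theorem tendsto_sum_range_div (hp : IsSubexponentialDensity p P) (v : ℕ → ℝ) (N : ℕ) :
    Tendsto (fun n => (∑ i ∈ Finset.range N, v i * coeff (n - i) p) / coeff n p) atTop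
      (𝓝 (∑ i ∈ Finset.range N, v i)) := by
  simp only [Finset.sum_div, mul_div_assoc]
  refine tendsto_finsetSum _ fun i _ => ?_
  simpa using (hp.tendsto_coeff_sub_div i).const_mul (v i)

theorem eventually_sum_Ico_le (hp : IsSubexponentialDensity p P) {ε : ℝ} (hε : 0 < ε) :
    ∀ᶠ N in atTop, ∀ᶠ n in atTop,
      ∑ i ∈ Finset.Ico N (n + 1), coeff i p * coeff (n - i) p ≤ (P + ε) * coeff n p := by
  filter_upwards [hp.hasSum.tendsto_sum_nat.eventually_const_lt (sub_lt_self P hε)] with N hN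
  have hlim := hp.conv.sub (hp.tendsto_sum_range_div (fun i => coeff i p) N)
  filter_upwards [hlim.eventually_lt_const (show _ < P + ε by linarith), hp.eventually_pos,
    eventually_ge_atTop N] with n hn hpos hNn
  rw [← sub_div, div_lt_iff₀ hpos,
    coeff_mul_eq_sum_range_add_sum_Ico _ _ (hNn.trans n.le_succ), add_sub_cancel_left] at hn
  exact hn.le

theorem abs_sum_Ico_le (hp : IsSubexponentialDensity p P) {v : ℕ → ℝ} {δ : ℝ} {N : ℕ}
    (hv : ∀ i ≥ N, |v i| ≤ δ * coeff i p) (n : ℕ) :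
    |∑ i ∈ Finset.Ico N (n + 1), v i * coeff (n - i) p|
      ≤ δ * ∑ i ∈ Finset.Ico N (n + 1), coeff i p * coeff (n - i) p := by
  rw [Finset.mul_sum]
  refine (Finset.abs_sum_le_sum_abs _ _).trans (Finset.sum_le_sum fun i hi => ?_)
  rw [abs_mul, abs_of_nonneg (hp.nonneg _), ← mul_assoc]
  exact mul_le_mul_of_nonneg_right (hv i (Finset.mem_Ico.1 hi).1) (hp.nonneg _)

theorem tendsto_coeff_mul_div_of_tendsto_zero (hp : IsSubexponentialDensity p P) {v : ℝ⟦X⟧}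
    {V : ℝ} (hv : HasSum (fun n => coeff n v) V)
    (hvp : Tendsto (fun n => coeff n v / coeff n p) atTop (𝓝 0)) :
    Tendsto (fun n => coeff n (v * p) / coeff n p) atTop (𝓝 V) := by
  rw [Metric.tendsto_nhds]
  intro ε hε
  have hP := hp.sum_pos
  obtain ⟨δ, hδ, hδε⟩ : ∃ δ > 0, δ * (P + 1) + 2 * δ = ε :=
    ⟨ε / (P + 3), by positivity, by field_simp; ring⟩
  have hsmall : ∀ᶠ N in atTop, ∀ i ≥ N, |coeff i v| ≤ δ * coeff i p := by
    rw [eventually_forall_ge_atTop]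
    filter_upwards [Metric.tendsto_nhds.1 hvp δ hδ, hp.eventually_pos] with i hi hpi
    rw [dist_zero_right, Real.norm_eq_abs, abs_div, abs_of_pos hpi, div_lt_iff₀ hpi] at hi
    exact hi.le
  have hpartial := Metric.tendsto_nhds.1 hv.tendsto_sum_nat δ hδ
  obtain ⟨N, hNv, hNV, hNp⟩ :=
    (hsmall.and (hpartial.and (hp.eventually_sum_Ico_le one_pos))).exists
  filter_upwards [Metric.tendsto_nhds.1 (hp.tendsto_sum_range_div (fun i => coeff i v) N) δ hδ,
    hNp, hp.eventually_pos, eventually_ge_atTop N] with n hhead hnp hpos hNn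
  have htail : |(∑ i ∈ Finset.Ico N (n + 1), coeff i v * coeff (n - i) p) / coeff n p|
      ≤ δ * (P + 1) := by
    rw [abs_div, abs_of_pos hpos, div_le_iff₀ hpos, mul_assoc]
    exact (hp.abs_sum_Ico_le hNv n).trans (mul_le_mul_of_nonneg_left hnp hδ.le)
  rw [Real.dist_eq] at hhead hNV ⊢
  rw [coeff_mul_eq_sum_range_add_sum_Ico _ _ (hNn.trans n.le_succ), add_div]
  rw [abs_lt] at hhead hNV ⊢
  rw [abs_le] at htail
  constructor <;> linarith

theorem tendsto_coeff_mul_div (hp : IsSubexponentialDensity p P) {v : ℝ⟦X⟧} {V α : ℝ}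
    (hv : HasSum (fun n => coeff n v) V)
    (hvp : Tendsto (fun n => coeff n v / coeff n p) atTop (𝓝 α)) :
    Tendsto (fun n => coeff n (v * p) / coeff n p) atTop (𝓝 (V + α * P)) := by
  have hsub : HasSum (fun n => coeff n (v - C α * p)) (V - α * P) := by
    simpa only [map_sub, coeff_C_mul] using hv.sub (hp.hasSum.mul_left α)
  have hsubp : Tendsto (fun n => coeff n (v - C α * p) / coeff n p) atTop (𝓝 0) := by
    rw [← sub_self α]
    refine (hvp.sub_const α).congr' ?_
    filter_upwards [hp.eventually_pos] with n hn
    rw [map_sub, coeff_C_mul, sub_div, mul_div_cancel_right₀ _ hn.ne']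
  have hlim := (hp.tendsto_coeff_mul_div_of_tendsto_zero hsub hsubp).add (hp.conv.const_mul α)
  rw [show V - α * P + α * (2 * P) = V + α * P by ring] at hlim
  refine hlim.congr fun n => ?_
  rw [sub_mul, mul_assoc, map_sub, coeff_C_mul]
  ring

theorem tendsto_coeff_pow_div (hp : IsSubexponentialDensity p P) (k : ℕ) :
    Tendsto (fun n => coeff n (p ^ k) / coeff n p) atTop (𝓝 (k * P ^ (k - 1))) := by
  induction k with
  | zero =>
    rw [Nat.cast_zero, zero_mul]
    refine tendsto_const_nhds.congr' ?_
    filter_upwards [eventually_ne_atTop 0] with n hn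
    rw [pow_zero, coeff_one, if_neg hn, zero_div]
  | succ k ih =>
    have hlim := hp.tendsto_coeff_mul_div (hasSum_coeff_pow hp.hasSum k) ih
    simp only [← pow_succ] at hlim
    convert hlim using 2
    cases k with
    | zero => simp
    | succ k =>
      push_cast [Nat.add_sub_cancel]
      ring

theorem posCoeff_pos (hp : IsSubexponentialDensity p P) (n : ℕ) : 0 < posCoeff p n := by
  rw [posCoeff]
  split_ifs with h
  exacts [one_pos, (hp.nonneg n).lt_of_ne' h]

theorem eventually_posCoeff_eq (hp : IsSubexponentialDensity p P) :
    ∀ᶠ n in atTop, posCoeff p n = coeff n p := by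
  filter_upwards [hp.eventually_pos] with n hn
  exact if_neg hn.ne'

theorem tendsto_posCoeff_div (hp : IsSubexponentialDensity p P) :
    Tendsto (fun n => posCoeff p n / posCoeff p (n + 1)) atTop (𝓝 1) := by
  refine hp.ratio.congr' ?_
  filter_upwards [hp.eventually_posCoeff_eq,
    (tendsto_add_atTop_nat 1).eventually hp.eventually_posCoeff_eq] with n hn hn'
  rw [hn, hn']

theorem exists_eventually_coeff_mul_le (hp : IsSubexponentialDensity p P) {ε : ℝ} (hε : 0 < ε) :
    ∃ L : ℝ, ∀ᶠ n in atTop, ∀ (u : ℝ⟦X⟧) (A B : ℝ), 0 ≤ A → 0 ≤ B → (∀ i, coeff i u ≤ B) →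
      (∀ i, coeff i u ≤ A * posCoeff p i) →
      coeff n (u * p) ≤ (B * L + A * (P + ε)) * coeff n p := by
  obtain ⟨N, hNp, hNpos⟩ := ((hp.eventually_sum_Ico_le hε).and
    (eventually_forall_ge_atTop.2 hp.eventually_posCoeff_eq)).exists
  have hhead := hp.tendsto_sum_range_div (fun _ => 1) N
  simp only [one_mul, Finset.sum_const, Finset.card_range, nsmul_one] at hhead
  refine ⟨N + 1, ?_⟩
  filter_upwards [hNp, hhead.eventually_lt_const (lt_add_one (N : ℝ)), hp.eventually_pos,
    eventually_ge_atTop N] with n htail hhead hpos hNn u A B hA hB huB huA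
  rw [div_lt_iff₀ hpos] at hhead
  rw [coeff_mul_eq_sum_range_add_sum_Ico _ _ (hNn.trans n.le_succ), add_mul, mul_assoc, mul_assoc]
  refine add_le_add ?_ ?_
  · refine le_trans ?_ (mul_le_mul_of_nonneg_left hhead.le hB)
    rw [Finset.mul_sum]
    exact Finset.sum_le_sum fun i _ => mul_le_mul_of_nonneg_right (huB i) (hp.nonneg _)
  · refine le_trans ?_ (mul_le_mul_of_nonneg_left htail hA)
    rw [Finset.mul_sum]
    refine Finset.sum_le_sum fun i hi => ?_
    rw [← mul_assoc, ← hNpos i (Finset.mem_Ico.1 hi).1]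
    exact mul_le_mul_of_nonneg_right (huA i) (hp.nonneg _)

/-- Kesten's bound. -/
theorem exists_coeff_pow_le (hp : IsSubexponentialDensity p P) {ε : ℝ} (hε : 0 < ε) :
    ∃ K, 0 < K ∧ ∀ k n, coeff n (p ^ k) ≤ K * (P + ε) ^ k * posCoeff p n := by
  have hP := hp.sum_pos
  obtain ⟨L, hL⟩ := hp.exists_eventually_coeff_mul_le (half_pos hε)
  obtain ⟨M, hM⟩ := eventually_atTop.1
    (hL.and (hp.eventually_posCoeff_eq.and (eventually_ne_atTop 0)))
  obtain ⟨K₁, hK₁⟩ := exists_forall_lt_le (fun n => (posCoeff p n)⁻¹) M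
  obtain ⟨K, hK0, hKL, hKK₁⟩ : ∃ K, 0 < K ∧ L / (ε / 2) ≤ K ∧ K₁ ≤ K :=
    ⟨max 1 (max (L / (ε / 2)) K₁), by simp, by simp, by simp⟩
  rw [div_le_iff₀ (half_pos hε)] at hKL
  have hpow_le (k n : ℕ) : coeff n (p ^ k) ≤ (P + ε) ^ k :=
    (hp.coeff_pow_le k n).trans (pow_le_pow_left₀ hP.le (by linarith) k)
  have hbelow (k n : ℕ) (hn : n < M) : coeff n (p ^ k) ≤ K * (P + ε) ^ k * posCoeff p n := by
    have hK : 1 ≤ K * posCoeff p n :=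
      (inv_le_iff_one_le_mul₀ (hp.posCoeff_pos n)).1 ((hK₁ n hn).trans hKK₁)
    rw [mul_right_comm]
    exact (hpow_le k n).trans (le_mul_of_one_le_left (by positivity) hK)
  refine ⟨K, hK0, fun k => ?_⟩
  induction k with
  | zero =>
    intro n
    rcases lt_or_ge n M with hn | hn
    · exact hbelow 0 n hn
    · rw [pow_zero, coeff_one, if_neg (hM n hn).2.2]
      exact mul_nonneg (by positivity) (hp.posCoeff_pos n).le
  | succ k ih =>
    intro n
    rcases lt_or_ge n M with hn | hn
    · exact hbelow (k + 1) n hn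
    obtain ⟨hstep, hposCoeff, -⟩ := hM n hn
    rw [hposCoeff, pow_succ]
    refine (hstep (p ^ k) _ _ (by positivity) (by positivity) (hpow_le k) ih).trans
      (mul_le_mul_of_nonneg_right ?_ (hp.nonneg n))
    calc (P + ε) ^ k * L + K * (P + ε) ^ k * (P + ε / 2)
        ≤ (P + ε) ^ k * (K * (ε / 2)) + K * (P + ε) ^ k * (P + ε / 2) := by gcongr
      _ = K * (P + ε) ^ (k + 1) := by ring

theorem exists_coeff_X_pow_mul_pow_le (hp : IsSubexponentialDensity p P) (μ : ℕ) {x : ℝ}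
    (hx : P < x) :
    ∃ K, ∀ k s, s ≤ μ * k → ∀ t,
      coeff t (X ^ s * p ^ k) ≤ K * x ^ k * posCoeff p t := by
  have hP := hp.sum_pos
  have hx0 : 0 < x := hP.trans hx
  obtain ⟨ε, hεx, hε⟩ : ∃ ε : ℝ, (P + ε) * (1 + ε) ^ μ < x ∧ 0 < ε := by
    have hcont : Continuous fun ε : ℝ => (P + ε) * (1 + ε) ^ μ := by fun_prop
    have hev := (hcont.tendsto 0).eventually_lt_const (by simpa using hx : _ < x)
    exact ((hev.filter_mono nhdsWithin_le_nhds).and (self_mem_nhdsWithin (s := Set.Ioi 0))).exists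
  obtain ⟨K, hK, hpow⟩ := hp.exists_coeff_pow_le hε
  obtain ⟨K', hK', hshift⟩ :=
    exists_forall_le_mul_one_add_pow hp.posCoeff_pos hp.tendsto_posCoeff_div hε
  refine ⟨K * K', fun k s hs t => ?_⟩
  have ht := hp.posCoeff_pos t
  rw [coeff_X_pow_mul']
  split_ifs with hst
  · calc coeff (t - s) (p ^ k) ≤ K * (P + ε) ^ k * posCoeff p (t - s) := hpow k (t - s)
      _ ≤ K * (P + ε) ^ k * (K' * (1 + ε) ^ s * posCoeff p t) := by
        gcongr
        exact hshift s t hst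
      _ ≤ K * (P + ε) ^ k * (K' * (1 + ε) ^ (μ * k) * posCoeff p t) := by
        gcongr
        linarith
      _ = K * K' * ((P + ε) * (1 + ε) ^ μ) ^ k * posCoeff p t := by
        rw [mul_pow, ← pow_mul]
        ring
      _ ≤ K * K' * x ^ k * posCoeff p t := by gcongr
  · positivity

theorem tendsto_coeff_X_pow_mul_pow_div (hp : IsSubexponentialDensity p P) (s k : ℕ) :
    Tendsto (fun t => coeff t (X ^ s * p ^ k) / coeff t p) atTop (𝓝 (k * P ^ (k - 1))) := by
  have hlim := ((hp.tendsto_coeff_pow_div k).comp (tendsto_sub_atTop_nat s)).mul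
    (hp.tendsto_coeff_sub_div s)
  rw [mul_one] at hlim
  refine hlim.congr' ?_
  filter_upwards [eventually_ge_atTop s,
    (tendsto_sub_atTop_nat s).eventually hp.eventually_pos] with t hst hpos
  rw [coeff_X_pow_mul', if_pos hst, Function.comp_apply, div_mul_div_cancel₀ hpos.ne']

theorem tendsto_tsum_coeff_pow_div (hp : IsSubexponentialDensity p P) {c : ℕ → ℝ}
    (hc : ∀ k, 0 ≤ c k) {s : ℕ → ℕ} {μ : ℕ} (hs : ∀ k, s k ≤ μ * k) {x : ℝ} (hx : P < x)
    (hsum : Summable fun k => c k * x ^ k) :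
    Tendsto (fun t => (∑' k, c k * coeff t (X ^ s k * p ^ k)) / coeff t p) atTop
      (𝓝 (∑' k, c k * (k * P ^ (k - 1)))) := by
  obtain ⟨K, hbound⟩ := hp.exists_coeff_X_pow_mul_pow_le μ hx
  simp only [← tsum_div_const, mul_div_assoc]
  refine tendsto_tsum_of_dominated_convergence (bound := fun k => K * (c k * x ^ k))
    (hsum.mul_left K)
    (fun k => (hp.tendsto_coeff_X_pow_mul_pow_div (s k) k).const_mul (c k)) ?_
  filter_upwards [hp.eventually_pos, hp.eventually_posCoeff_eq] with t hpos hposCoeff k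
  have hnonneg : 0 ≤ coeff t (X ^ s k * p ^ k) :=
    coeff_X_pow_mul_nonneg (coeff_pow_nonneg hp.nonneg k) _ _
  rw [Real.norm_of_nonneg (mul_nonneg (hc k) (div_nonneg hnonneg hpos.le)), mul_left_comm]
  refine mul_le_mul_of_nonneg_left ?_ (hc k)
  rw [div_le_iff₀ hpos, ← hposCoeff]
  exact hbound k (s k) (hs k) t

end IsSubexponentialDensity

namespace WeightedSpecies

variable {U V : Type}

namespace SetPartition

theorem disjoint_of_ne (π : SetPartition U) {Q Q' : π.1} (h : Q ≠ Q') : Disjoint Q.1 Q'.1 :=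
  Set.disjoint_left.2 fun u hu hu' =>
    h (Subtype.ext ((π.2.2 u).unique ⟨Q.2, hu⟩ ⟨Q'.2, hu'⟩))

/-- The partition of `U` obtained by adding the class `A` to a partition of its complement. -/
def insertClass {A : Set U} (hA : A.Nonempty) (τ : SetPartition ↥(Aᶜ)) : SetPartition U :=
  ⟨insert A ((fun P => Subtype.val '' P) '' τ.1), by
    constructor
    · rintro (h | ⟨P, hP, h⟩)
      · exact hA.ne_empty h.symm
      · exact τ.2.1 (Set.image_eq_empty.1 h ▸ hP)
    intro u
    by_cases hu : u ∈ A
    · refine ⟨A, ⟨Set.mem_insert _ _, hu⟩, ?_⟩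
      rintro Q ⟨rfl | ⟨P, -, rfl⟩, huQ⟩
      · rfl
      · obtain ⟨v, -, rfl⟩ := huQ
        exact absurd hu v.2
    · obtain ⟨P, ⟨hP, huP⟩, huniq⟩ := τ.2.2 ⟨u, hu⟩
      refine ⟨Subtype.val '' P, ⟨Set.mem_insert_of_mem _ ⟨P, hP, rfl⟩, ⟨_, huP, rfl⟩⟩, ?_⟩
      rintro Q ⟨rfl | ⟨P', hP', rfl⟩, huQ⟩
      · exact absurd huQ hu
      · obtain ⟨v, hv, rfl⟩ := huQ
        rw [huniq P' ⟨hP', hv⟩]⟩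

theorem erase_insertClass {A : Set U} (hA : A.Nonempty) (τ : SetPartition ↥(Aᶜ)) :
    (insertClass hA τ).erase ⟨A, Set.mem_insert _ _⟩ = τ := by
  ext P
  change (_ = A ∨ _ ∈ _) ↔ _
  constructor
  · rintro (h | ⟨P', hP', h⟩)
    · exact absurd h ((insertClass hA τ).image_ne ⟨A, Set.mem_insert _ _⟩ P)
    · rwa [← Subtype.val_injective.image_injective h]
  · exact fun h => Or.inr ⟨P, h, rfl⟩

/-- `SetPartition.erase` as a function on the partitions that have `A` as a class. -/
def eraseClass (A : Set U) (π : {π : SetPartition U // A ∈ π.1}) : SetPartition ↥(Aᶜ) :=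
  π.1.erase ⟨A, π.2⟩

theorem subset_of_eraseClass_eq {A : Set U} {π π' : {π : SetPartition U // A ∈ π.1}}
    (h : eraseClass A π = eraseClass A π') : π.1.1 ⊆ π'.1.1 := by
  intro Q hQ
  by_cases hQA : Q = A
  · exact hQA ▸ π'.2
  have himage := π.1.image_preimage_of_ne ⟨A, π.2⟩ ⟨Q, hQ⟩ fun h => hQA (congrArg Subtype.val h)
  have hmem : (Subtype.val ⁻¹' Q : Set ↥(Aᶜ)) ∈ (eraseClass A π).1 := by
    change Subtype.val '' (Subtype.val ⁻¹' Q : Set ↥(Aᶜ)) ∈ π.1.1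
    rwa [himage]
  rw [h] at hmem
  change Subtype.val '' (Subtype.val ⁻¹' Q : Set ↥(Aᶜ)) ∈ π'.1.1 at hmem
  rwa [himage] at hmem

theorem eraseClass_bijective {A : Set U} (hA : A.Nonempty) :
    Function.Bijective (eraseClass A) := by
  refine ⟨fun π π' h => ?_, fun τ =>
    ⟨⟨insertClass hA τ, Set.mem_insert _ _⟩, erase_insertClass hA τ⟩⟩
  exact Subtype.ext (Subtype.ext
    ((subset_of_eraseClass_eq h).antisymm (subset_of_eraseClass_eq h.symm)))

end SetPartition

variable [Finite U] [Finite V] (F G : WeightedSpecies)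

/-- Transport of structures along a bijection of the labels, as a bijection. -/
def mapEquiv (σ : U ≃ V) : F.obj U ≃ F.obj V where
  toFun := F.map σ
  invFun := F.map σ.symm
  left_inv x := by rw [← F.map_trans, Equiv.self_trans_symm, F.map_refl]
  right_inv x := by rw [← F.map_trans, Equiv.symm_trans_self, F.map_refl]

/-- The map `split` below, over a fixed partition `π` with class `A`. -/
def splitFiber {A : Set U} (π : SetPartition U) (hA : A ∈ π.1)
    (S : F.obj π.1 × ∀ Q : π.1, G.obj Q.1) :
    (F.obj (Option (π.erase ⟨A, hA⟩).1) × ∀ P : (π.erase ⟨A, hA⟩).1, G.obj P.1) × G.obj A :=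
  ((F.map (π.eraseEquiv ⟨A, hA⟩) S.1, fun P =>
    G.map (Equiv.Set.image Subtype.val P.1 Subtype.val_injective).symm
      (S.2 ⟨Subtype.val '' P.1, P.2⟩)), S.2 ⟨A, hA⟩)

theorem splitFiber_bijective {A : Set U} (π : SetPartition U) (hA : A ∈ π.1) :
    Function.Bijective (F.splitFiber G π hA) := by
  set e := π.eraseEquiv ⟨A, hA⟩
  constructor
  · rintro ⟨x, y⟩ ⟨x', y'⟩ h
    have hx := (F.mapEquiv e).injective (congrArg (fun z => z.1.1) h)
    have hy := congrArg (fun z => z.1.2) h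
    have hA' : y ⟨A, hA⟩ = y' ⟨A, hA⟩ := congrArg (fun z => z.2) h
    refine Prod.ext hx (funext fun Q => ?_)
    obtain ⟨o, rfl⟩ := e.symm.surjective Q
    cases o with
    | none => exact hA'
    | some P => exact (G.mapEquiv _).injective (congrFun hy P)
  · rintro ⟨⟨x, y⟩, z⟩
    let w : ∀ o, G.obj (e.symm o).1 := fun o =>
      match o with
      | none => z
      | some P => G.map (Equiv.Set.image Subtype.val P.1 Subtype.val_injective) (y P)
    have hw : ∀ o, Equiv.piCongrLeft (fun Q : π.1 => G.obj Q.1) e.symm w (e.symm o) = w o :=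
      Equiv.piCongrLeft_apply_apply _ _ _
    refine ⟨(F.map e.symm x, Equiv.piCongrLeft (fun Q : π.1 => G.obj Q.1) e.symm w),
      Prod.ext (Prod.ext ((F.mapEquiv e).apply_symm_apply x) (funext fun P => ?_)) (hw none)⟩
    exact (congrArg (G.map _) (hw (some P))).trans ((G.mapEquiv _).symm_apply_apply (y P))

/-- Splitting a composite structure with component `A` into this component and the rest. -/
def split (A : Set U) (S : {S : (F.comp G).obj U // A ∈ S.1.1}) :
    (F.deriv.comp G).obj ↥(Aᶜ) × G.obj A :=
  (F.eraseComponent G S.1 ⟨A, S.2⟩, S.1.2.2 ⟨A, S.2⟩)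

theorem split_bijective {A : Set U} (hA : A.Nonempty) : Function.Bijective (F.split G A) := by
  let f : (Σ π : {π : SetPartition U // A ∈ π.1}, F.obj π.1.1 × ∀ Q : π.1.1, G.obj Q.1) →
      Σ τ : SetPartition ↥(Aᶜ), (F.obj (Option τ.1) × ∀ P : τ.1, G.obj P.1) × G.obj A :=
    Sigma.map (SetPartition.eraseClass A) fun π => F.splitFiber G π.1 π.2
  have hf : Function.Bijective f :=
    ⟨(SetPartition.eraseClass_bijective hA).1.sigma_map
        fun π => (F.splitFiber_bijective G π.1 π.2).1,
      (SetPartition.eraseClass_bijective hA).2.sigma_map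
        fun π => (F.splitFiber_bijective G π.1 π.2).2⟩
  let e₁ : {S : (F.comp G).obj U // A ∈ S.1.1} ≃
      Σ π : {π : SetPartition U // A ∈ π.1}, F.obj π.1.1 × ∀ Q : π.1.1, G.obj Q.1 :=
    { toFun := fun S => ⟨⟨S.1.1, S.2⟩, S.1.2⟩
      invFun := fun S => ⟨⟨S.1.1, S.2⟩, S.1.2⟩ }
  let e₂ : (Σ τ : SetPartition ↥(Aᶜ), (F.obj (Option τ.1) × ∀ P : τ.1, G.obj P.1) × G.obj A) ≃
      (F.deriv.comp G).obj ↥(Aᶜ) × G.obj A :=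
    { toFun := fun S => (⟨S.1, S.2.1⟩, S.2.2)
      invFun := fun S => ⟨S.1.1, S.1.2, S.2⟩ }
  exact (e₂.bijective.comp hf).comp e₁.bijective

theorem weight_split {A : Set U} (S : {S : (F.comp G).obj U // A ∈ S.1.1}) :
    (F.comp G).weight S.1
      = (F.deriv.comp G).weight (F.split G A S).1 * G.weight (F.split G A S).2 := by
  obtain ⟨⟨π, x, y⟩, hA⟩ := S
  let _ : Fintype (π.erase ⟨A, hA⟩).1 := Fintype.ofFinite _
  simp only [comp, deriv, split, eraseComponent, F.weight_map, G.weight_map]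
  rw [mul_assoc, ← finprod_comp (g := fun Q => G.weight (y Q)) _
    (π.eraseEquiv ⟨A, hA⟩).symm.bijective, finprod_eq_prod_of_fintype,
    Fintype.prod_option, finprod_eq_prod_of_fintype, mul_comm (∏ _, _)]
  rfl

/-- The total weight of the structures on `{1, …, n}`. -/
def mass (n : ℕ) : ℝ≥0 := ∑' x : F.obj (Fin n), F.weight x

theorem coe_mass (n : ℕ) : (F.mass n : ℝ≥0∞) = ∑' x : F.obj (Fin n), (F.weight x : ℝ≥0∞) := by
  let _ := Fintype.ofFinite (F.obj (Fin n))
  rw [mass, tsum_fintype, tsum_fintype, ENNReal.ofNNReal_finsetSum]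

theorem tsum_weight : ∑' x : F.obj U, (F.weight x : ℝ≥0∞) = F.mass (Nat.card U) := by
  rw [coe_mass, ← (F.mapEquiv (Finite.equivFin U)).tsum_eq]
  exact tsum_congr fun x => by rw [← F.weight_map (Finite.equivFin U) x]; rfl

theorem coe_mass_eq_factorial_mul_coeff_egf (n : ℕ) :
    (F.mass n : ℝ) = n.factorial * coeff n F.egf := by
  let _ := Fintype.ofFinite (F.obj (Fin n))
  have hn : (n.factorial : ℝ) ≠ 0 := mod_cast n.factorial_ne_zero
  rw [egf, coeff_mk, mass, tsum_fintype, finsum_eq_sum_of_fintype, NNReal.coe_sum,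
    mul_div_cancel₀ _ hn]

theorem coeff_egf (n : ℕ) : coeff n F.egf = F.mass n / n.factorial := by
  have hn : (n.factorial : ℝ) ≠ 0 := mod_cast n.factorial_ne_zero
  rw [coe_mass_eq_factorial_mul_coeff_egf, mul_div_cancel_left₀ _ hn]

theorem coeff_egf_nonneg (n : ℕ) : 0 ≤ coeff n F.egf := by
  rw [coeff_egf]
  positivity

theorem coeff_egf_ne_zero_of_weight_ne_zero {n : ℕ} {x : F.obj (Fin n)} (hx : F.weight x ≠ 0) :
    coeff n F.egf ≠ 0 := by
  have hle : F.weight x ≤ F.mass n := by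
    rw [← ENNReal.coe_le_coe, coe_mass]
    exact ENNReal.le_tsum x
  rw [coeff_egf]
  have : F.mass n ≠ 0 := (pos_of_ne_zero hx).trans_le hle |>.ne'
  positivity

theorem coeff_egf_restrict (D a k : ℕ) :
    coeff k (F.restrict D a).egf = if k ≡ a [MOD D] then coeff k F.egf else 0 := by
  rw [coeff_egf, coeff_egf]
  split_ifs with h
  · congr 2
    exact (Equiv.subtypeUnivEquiv fun _ : F.obj (Fin k) =>
      (show Nat.card (Fin k) ≡ a [MOD D] by rwa [Nat.card_fin])).tsum_eq F.weight
  · have : IsEmpty ((F.restrict D a).obj (Fin k)) :=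
      ⟨fun x => h (by simpa only [Nat.card_fin] using x.2)⟩
    simp [mass]

theorem coeff_egf_deriv (k : ℕ) : coeff k F.deriv.egf = (k + 1) * coeff (k + 1) F.egf := by
  have hmass : F.deriv.mass k = F.mass (k + 1) := by
    rw [← ENNReal.coe_inj, coe_mass]
    refine (F.tsum_weight (U := Option (Fin k))).trans ?_
    rw [Finite.card_option, Nat.card_fin]
  rw [coeff_egf, coeff_egf, hmass, Nat.factorial_succ]
  push_cast
  field_simp

theorem sum_apply_card_set {M : Type*} [AddCommMonoid M] (n : ℕ) (f : ℕ → ℕ → M) :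
    ∑ A : Set (Fin n), f (Nat.card A) (Nat.card ↥(Aᶜ))
      = ∑ ij ∈ Finset.HasAntidiagonal.antidiagonal n, n.choose ij.1 • f ij.1 ij.2 := by
  classical
  have hpow := Finset.sum_powerset_apply_card (fun i => f i (n - i))
    (x := (Finset.univ : Finset (Fin n)))
  rw [Finset.powerset_univ, Finset.card_univ, Fintype.card_fin] at hpow
  rw [Finset.Nat.sum_antidiagonal_eq_sum_range_succ_mk, ← hpow,
    ← Fintype.finsetEquivSet.sum_comp]
  refine Finset.sum_congr rfl fun A _ => ?_
  have hcompl : Nat.card ↥((Fintype.finsetEquivSet A)ᶜ) = n - A.card := by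
    rw [Fintype.finsetEquivSet_apply, Nat.card_coe_set_eq, Set.ncard_compl, Set.ncard_coe_finset,
      Nat.card_fin]
  rw [hcompl, Fintype.finsetEquivSet_apply, Nat.card_coe_set_eq, Set.ncard_coe_finset]

section Remainder

variable {n : ℕ}

theorem tsum_map_increasingRelabelling (A : Set (Fin n)) (φ : F.Universe → ℝ≥0∞) :
    ∑' x : F.obj A, (F.weight x : ℝ≥0∞) * φ ⟨_, F.map (increasingRelabelling A) x⟩
      = ∑' x : F.obj (Fin (Nat.card A)), (F.weight x : ℝ≥0∞) * φ ⟨_, x⟩ := by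
  rw [← (F.mapEquiv (increasingRelabelling A)).tsum_eq]
  exact tsum_congr fun x => congrArg (· * _)
    (congrArg ENNReal.ofNNReal (F.weight_map (increasingRelabelling A) x).symm)

theorem tsum_remainder_of_nonempty {A : Set (Fin n)} (hA : A.Nonempty)
    (φ : (F.deriv.comp G).Universe → ℝ≥0∞) :
    ∑' S : {S : (F.comp G).obj (Fin n) // A ∈ S.1.1},
        ((F.comp G).weight S.1 : ℝ≥0∞) * φ (F.remainder G S.1 ⟨A, S.2⟩)
      = G.mass (Nat.card A) * ∑' R : (F.deriv.comp G).obj (Fin (Nat.card ↥(Aᶜ))),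
          ((F.deriv.comp G).weight R : ℝ≥0∞) * φ ⟨_, R⟩ := by
  rw [← tsum_map_increasingRelabelling, ← tsum_weight, ← ENNReal.tsum_mul_left]
  calc ∑' S : {S : (F.comp G).obj (Fin n) // A ∈ S.1.1},
        ((F.comp G).weight S.1 : ℝ≥0∞) * φ (F.remainder G S.1 ⟨A, S.2⟩)
      = ∑' z : (F.deriv.comp G).obj ↥(Aᶜ) × G.obj A, (G.weight z.2 : ℝ≥0∞) *
          (((F.deriv.comp G).weight z.1 : ℝ≥0∞) *
            φ ⟨_, (F.deriv.comp G).map (increasingRelabelling (Aᶜ)) z.1⟩) := by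
        rw [← (Equiv.ofBijective _ (F.split_bijective G hA)).tsum_eq]
        refine tsum_congr fun S => ?_
        rw [weight_split, ENNReal.coe_mul, mul_comm (ENNReal.ofNNReal _), mul_assoc]
        rfl
    _ = _ := by simp only [ENNReal.tsum_prod', ENNReal.tsum_mul_right]

theorem tsum_remainder [IsEmpty (G.obj (Fin 0))] (φ : (F.deriv.comp G).Universe → ℝ≥0∞) :
    ∑' S : (F.comp G).obj (Fin n), ∑' Q : S.1.1,
        ((F.comp G).weight S : ℝ≥0∞) * φ (F.remainder G S Q)
      = ∑ ij ∈ Finset.HasAntidiagonal.antidiagonal n, n.choose ij.1 • (G.mass ij.1 *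
          ∑' R : (F.deriv.comp G).obj (Fin ij.2),
            ((F.deriv.comp G).weight R : ℝ≥0∞) * φ ⟨ij.2, R⟩) := by
  let e : (Σ A : Set (Fin n), {S : (F.comp G).obj (Fin n) // A ∈ S.1.1}) ≃
      Σ S : (F.comp G).obj (Fin n), S.1.1 :=
    { toFun := fun x => ⟨x.2.1, x.1, x.2.2⟩
      invFun := fun x => ⟨x.2.1, x.1, x.2.2⟩ }
  rw [← sum_apply_card_set n fun i j => (G.mass i : ℝ≥0∞) *
      ∑' R : (F.deriv.comp G).obj (Fin j), ((F.deriv.comp G).weight R : ℝ≥0∞) * φ ⟨j, R⟩,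
    ← ENNReal.tsum_sigma' fun x : Σ S : (F.comp G).obj (Fin n), S.1.1 =>
      ((F.comp G).weight x.1 : ℝ≥0∞) * φ (F.remainder G x.1 x.2),
    ← e.tsum_eq, ENNReal.tsum_sigma', tsum_fintype]
  refine Finset.sum_congr rfl fun A _ => ?_
  rcases A.eq_empty_or_nonempty with rfl | hA
  · have hempty : IsEmpty {S : (F.comp G).obj (Fin n) // ∅ ∈ S.1.1} := ⟨fun S => S.1.1.2.1 S.2⟩
    have hmass : G.mass 0 = 0 := by rw [mass, tsum_empty]
    rw [tsum_empty, Nat.card_of_isEmpty, hmass, ENNReal.coe_zero, zero_mul]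
  · exact F.tsum_remainder_of_nonempty G hA φ

end Remainder

theorem tsum_card_mul_weight_comp [IsEmpty (G.obj (Fin 0))] (n : ℕ) :
    ∑' S : (F.comp G).obj (Fin n), (Nat.card S.1.1 : ℝ≥0∞) * (F.comp G).weight S
      = ∑ ij ∈ Finset.HasAntidiagonal.antidiagonal n,
          n.choose ij.1 • ((G.mass ij.1 : ℝ≥0∞) * (F.deriv.comp G).mass ij.2) := by
  have hsum := F.tsum_remainder G (n := n) fun _ => 1
  simp only [mul_one, ← coe_mass] at hsum
  rw [← hsum]
  refine tsum_congr fun S => ?_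
  let _ := Fintype.ofFinite S.1.1
  rw [tsum_fintype, Finset.sum_const, Finset.card_univ, nsmul_eq_mul, Nat.card_eq_fintype_card]

theorem mass_comp_zero : (F.comp G).mass 0 = F.mass 0 := by
  have hempty : ∀ π : SetPartition (Fin 0), π.1 = ∅ := fun π =>
    Set.eq_empty_of_forall_notMem fun Q hQ => π.2.1 (Q.eq_empty_of_isEmpty ▸ hQ)
  let _ : Unique (SetPartition (Fin 0)) :=
    { default := ⟨∅, id, fun u => u.elim0⟩
      uniq := fun π => Subtype.ext (hempty π) }
  have hclass (π : SetPartition (Fin 0)) : IsEmpty π.1 := Set.isEmpty_coe_sort.2 (hempty π)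
  have hweight (S : (F.comp G).obj (Fin 0)) : (F.comp G).weight S = F.weight S.2.1 :=
    (congrArg (F.weight S.2.1 * ·) (finprod_of_isEmpty _)).trans (mul_one _)
  have hfiber : ∑' x : F.obj (default : SetPartition (Fin 0)).1, (F.weight x : ℝ≥0∞)
      = F.mass 0 := by
    rw [tsum_weight, Nat.card_of_isEmpty]
  rw [← ENNReal.coe_inj, coe_mass, ← hfiber]
  simp only [hweight]
  refine (ENNReal.tsum_sigma' (β := fun π : SetPartition (Fin 0) =>
    F.obj π.1 × ∀ Q : π.1, G.obj Q.1) fun S => (F.weight S.2.1 : ℝ≥0∞)).trans ?_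
  rw [(hasSum_unique _).tsum_eq, ENNReal.tsum_prod']
  exact tsum_congr fun x => (hasSum_unique _).tsum_eq

/-- All structures of the species have size `k`. -/
def IsConcentratedOn (k : ℕ) : Prop :=
  ∀ (U : Type) [Finite U], Nonempty (F.obj U) → Nat.card U = k

variable {F} in
theorem IsConcentratedOn.deriv {k : ℕ} (hF : F.IsConcentratedOn (k + 1)) :
    F.deriv.IsConcentratedOn k := fun U _ hU => by
  have hcard := hF (Option U) hU
  rwa [Finite.card_option, Nat.add_right_cancel_iff] at hcard

theorem isConcentratedOn_restrict_zero (k : ℕ) : (F.restrict 0 k).IsConcentratedOn k :=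
  fun _ _ ⟨x⟩ => Nat.modEq_zero_iff.1 x.2

variable {F} in
theorem IsConcentratedOn.mul_egf_comp {k : ℕ} (hF : F.IsConcentratedOn k)
    [IsEmpty (G.obj (Fin 0))] :
    C (k : ℝ) * (F.comp G).egf = G.egf * (F.deriv.comp G).egf := by
  ext n
  have hmass : (k : ℝ≥0) * (F.comp G).mass n = ∑ ij ∈ Finset.HasAntidiagonal.antidiagonal n,
      n.choose ij.1 • (G.mass ij.1 * (F.deriv.comp G).mass ij.2) := by
    rw [← ENNReal.coe_inj]
    push_cast
    simp only [← F.tsum_card_mul_weight_comp G, coe_mass (F.comp G),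
      ← ENNReal.tsum_mul_left]
    exact tsum_congr fun S => by rw [hF _ ⟨S.2.1⟩]
  rw [coeff_C_mul, coeff_mul, coeff_egf (F.comp G), ← mul_div_assoc,
    div_eq_iff (mod_cast n.factorial_ne_zero), Finset.sum_mul]
  rw [← NNReal.coe_inj] at hmass
  push_cast at hmass
  rw [hmass]
  refine Finset.sum_congr rfl fun ij hij => ?_
  rw [← Finset.HasAntidiagonal.mem_antidiagonal.1 hij, coe_mass_eq_factorial_mul_coeff_egf,
    coe_mass_eq_factorial_mul_coeff_egf, Nat.choose_symm_add,
    ← Nat.add_choose_mul_factorial_mul_factorial]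
  push_cast [nsmul_eq_mul]
  ring

variable {F} in
theorem IsConcentratedOn.egf_comp_of_zero (hF : F.IsConcentratedOn 0) :
    (F.comp G).egf = C (coeff 0 F.egf) := by
  ext n
  rw [coeff_C]
  split_ifs with hn
  · subst hn
    rw [coeff_egf, coeff_egf, mass_comp_zero]
  · have : IsEmpty ((F.comp G).obj (Fin n)) := ⟨fun S => ?_⟩
    · simp [coeff_egf, mass]
    have : Nonempty (Fin n) := Fin.pos_iff_nonempty.1 (Nat.pos_of_ne_zero hn)
    have : Nonempty S.1.1 := ⟨S.1.largest_nonempty.choose⟩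
    exact Nat.card_pos.ne' (hF _ ⟨S.2.1⟩)

variable {F} in
theorem IsConcentratedOn.egf_comp {k : ℕ} (hF : F.IsConcentratedOn k)
    [IsEmpty (G.obj (Fin 0))] :
    (F.comp G).egf = C (coeff k F.egf) * G.egf ^ k := by
  induction k generalizing F with
  | zero => rw [hF.egf_comp_of_zero G, pow_zero, mul_one]
  | succ k ih =>
    have hk : C ((k + 1 : ℕ) : ℝ) ≠ (0 : ℝ⟦X⟧) := by
      rw [map_ne_zero_iff _ C_injective]
      exact_mod_cast k.succ_ne_zero
    refine mul_left_cancel₀ hk ?_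
    rw [hF.mul_egf_comp G, ih hF.deriv, coeff_egf_deriv, map_mul, pow_succ]
    push_cast
    ring

/-- Composite structures, sorted by their number of components. -/
def sigmaRestrictCompEquiv (U : Type) [Finite U] :
    (Σ k, ((F.restrict 0 k).comp G).obj U) ≃ (F.comp G).obj U where
  toFun S := ⟨S.2.1, S.2.2.1.1, S.2.2.2⟩
  invFun S := ⟨Nat.card S.1.1, S.1, ⟨S.2.1, rfl⟩, S.2.2⟩
  left_inv := by
    rintro ⟨k, π, ⟨x, hx⟩, y⟩
    obtain rfl := Nat.modEq_zero_iff.1 hx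
    rfl

theorem hasSum_coeff_egf_comp [IsEmpty (G.obj (Fin 0))] (n : ℕ) :
    HasSum (fun k => coeff k F.egf * coeff n (G.egf ^ k)) (coeff n (F.comp G).egf) := by
  have hmass : HasSum (fun k => ((F.restrict 0 k).comp G).mass n) ((F.comp G).mass n) := by
    rw [← ENNReal.hasSum_coe, coe_mass, ← (F.sigmaRestrictCompEquiv G (Fin n)).tsum_eq,
      ENNReal.tsum_sigma']
    simp only [coe_mass]
    exact ENNReal.summable.hasSum
  have hcoeff := (NNReal.hasSum_coe.2 hmass).div_const (n.factorial : ℝ)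
  simp only [← coeff_egf] at hcoeff
  refine hcoeff.congr_fun fun k => ?_
  rw [(F.isConcentratedOn_restrict_zero k).egf_comp G, coeff_C_mul, coeff_egf_restrict,
    if_pos (Nat.ModEq.refl k)]

theorem hasSum_coeff_rescale_egf_comp [IsEmpty (G.obj (Fin 0))] (y : ℝ) (n : ℕ) :
    HasSum (fun k => coeff k F.egf * coeff n (rescale y G.egf ^ k))
      (coeff n (rescale y (F.comp G).egf)) := by
  rw [coeff_rescale]
  refine ((F.hasSum_coeff_egf_comp G n).mul_left (y ^ n)).congr_fun fun k => ?_
  rw [← map_pow, coeff_rescale, mul_left_comm]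

theorem coeff_egf_pow_ne_zero_of_weight_ne_zero [IsEmpty (G.obj (Fin 0))] {n : ℕ}
    {S : (F.comp G).obj (Fin n)} (hS : (F.comp G).weight S ≠ 0) :
    coeff n (G.egf ^ Nat.card S.1.1) ≠ 0 := by
  have hcoeff := coeff_egf_ne_zero_of_weight_ne_zero _
    (x := ((F.sigmaRestrictCompEquiv G (Fin n)).symm S).2) hS
  rw [(F.isConcentratedOn_restrict_zero _).egf_comp G, coeff_C_mul] at hcoeff
  exact right_ne_zero_of_mul hcoeff

theorem value_eq_tsum_ofReal (y : ℝ≥0) :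
    F.value y = ∑' n, ENNReal.ofReal (coeff n (rescale (y : ℝ) F.egf)) := by
  rw [value, ENNReal.tsum_sigma']
  refine tsum_congr fun n => ?_
  have hcoeff : coeff n (rescale (y : ℝ) F.egf)
      = ((F.mass n * (y ^ n / n.factorial) : ℝ≥0) : ℝ) := by
    rw [coeff_rescale, coeff_egf]
    push_cast
    ring
  rw [hcoeff, ENNReal.ofReal_coe_nnreal, ENNReal.coe_mul, coe_mass, ← ENNReal.tsum_mul_right]
  simp only [boltzmannWeight, mul_div_assoc, ENNReal.coe_mul]

theorem value_eq_ofReal {y : ℝ≥0} {P : ℝ}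
    (hP : HasSum (fun n => coeff n (rescale (y : ℝ) F.egf)) P) :
    F.value y = ENNReal.ofReal P := by
  rw [value_eq_tsum_ofReal, ← hP.tsum_eq, ENNReal.ofReal_tsum_of_nonneg _ hP.summable]
  intro n
  rw [coeff_rescale]
  exact mul_nonneg (by positivity) (F.coeff_egf_nonneg n)

theorem value_comp_eq_ofReal [IsEmpty (G.obj (Fin 0))] {y : ℝ≥0} {P V : ℝ}
    (hP : HasSum (fun n => coeff n (rescale (y : ℝ) G.egf)) P)
    (hV : HasSum (fun k => coeff k F.egf * P ^ k) V) :
    (F.comp G).value y = ENNReal.ofReal V := by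
  have hG (n : ℕ) : 0 ≤ coeff n (rescale (y : ℝ) G.egf) := by
    rw [coeff_rescale]
    exact mul_nonneg (by positivity) (G.coeff_egf_nonneg n)
  have hterm (k n : ℕ) : 0 ≤ coeff k F.egf * coeff n (rescale (y : ℝ) G.egf ^ k) :=
    mul_nonneg (F.coeff_egf_nonneg k) (coeff_pow_nonneg hG k n)
  have hP0 : 0 ≤ P := hP.nonneg hG
  calc (F.comp G).value y
      = ∑' n, ∑' k, ENNReal.ofReal (coeff k F.egf * coeff n (rescale (y : ℝ) G.egf ^ k)) := by
        rw [value_eq_tsum_ofReal]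
        refine tsum_congr fun n => ?_
        have hsum := F.hasSum_coeff_rescale_egf_comp G y n
        rw [← hsum.tsum_eq, ENNReal.ofReal_tsum_of_nonneg (hterm · n) hsum.summable]
    _ = ∑' k, ENNReal.ofReal (coeff k F.egf * P ^ k) := by
        rw [ENNReal.tsum_comm]
        refine tsum_congr fun k => ?_
        have hsum := (hasSum_coeff_pow hP k).mul_left (coeff k F.egf)
        rw [← hsum.tsum_eq, ENNReal.ofReal_tsum_of_nonneg (hterm k) hsum.summable]
    _ = ENNReal.ofReal V := by
        rw [← hV.tsum_eq, ENNReal.ofReal_tsum_of_nonneg _ hV.summable]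
        exact fun k => mul_nonneg (F.coeff_egf_nonneg k) (by positivity)

theorem value_deriv_comp_eq_ofReal [IsEmpty (G.obj (Fin 0))] {y : ℝ≥0} {P V : ℝ}
    (hP : HasSum (fun n => coeff n (rescale (y : ℝ) G.egf)) P)
    (hV : HasSum (fun k : ℕ => coeff k F.egf * (k * P ^ (k - 1))) V) :
    (F.deriv.comp G).value y = ENNReal.ofReal V := by
  refine F.deriv.value_comp_eq_ofReal G hP ?_
  have hshift := (hasSum_nat_add_iff' 1).2 hV
  simp only [Finset.range_one, Finset.sum_singleton, Nat.cast_zero, zero_mul, mul_zero,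
    sub_zero, Nat.add_sub_cancel] at hshift
  refine hshift.congr_fun fun k => ?_
  rw [coeff_egf_deriv]
  push_cast
  ring

namespace SetPartition

variable (π : SetPartition U)

theorem card_add_card_le {Q Q' : π.1} (h : Q ≠ Q') :
    Nat.card Q.1 + Nat.card Q'.1 ≤ Nat.card U := by
  simp only [Nat.card_coe_set_eq]
  rw [← Set.ncard_union_eq (π.disjoint_of_ne h)]
  exact Set.ncard_le_card _

theorem mem_largest {Q : π.1} :
    Q ∈ π.largest ↔ ∀ Q' : π.1, Nat.card Q'.1 ≤ Nat.card Q.1 := by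
  simp [largest]

theorem largest_eq_singleton {Q : π.1} (hQ : Nat.card U < 2 * Nat.card Q.1) :
    π.largest = {Q} := by
  have hlt (Q' : π.1) (hne : Q' ≠ Q) : Nat.card Q'.1 < Nat.card Q.1 := by
    have := π.card_add_card_le hne
    omega
  ext Q'
  rw [mem_largest, Finset.mem_singleton]
  constructor
  · intro hQ'
    by_contra hne
    exact (hQ' Q).not_gt (hlt Q' hne)
  · rintro rfl Q''
    rcases eq_or_ne Q'' Q' with rfl | hne
    exacts [le_rfl, (hlt Q'' hne).le]

end SetPartition

section RemainderLaw

variable {n : ℕ}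

open Classical in
theorem map_remainder_apply (S : (F.comp G).obj (Fin n)) (hS : S.1.largest.Nonempty)
    (R : (F.deriv.comp G).Universe) (hR : 2 * R.1 < n) :
    (PMF.uniformOfFinset S.1.largest hS).map (F.remainder G S) R
      = ∑' Q : S.1.1, if F.remainder G S Q = R then 1 else 0 := by
  rw [PMF.map_apply]
  refine tsum_congr fun Q => ?_
  simp only [eq_comm (a := R)]
  refine ite_congr rfl (fun hQR => ?_) fun _ => rfl
  have hlarge : Nat.card (Fin n) < 2 * Nat.card Q.1 := by
    have hsize : Nat.card ↥(Q.1ᶜ) = R.1 := congrArg Sigma.fst hQR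
    have hcompl := Set.ncard_add_ncard_compl Q.1
    rw [← Nat.card_coe_set_eq, ← Nat.card_coe_set_eq, hsize] at hcompl
    rw [Nat.card_fin] at hcompl ⊢
    omega
  simp [PMF.uniformOfFinset_apply, S.1.largest_eq_singleton hlarge]

open Classical in
theorem tsum_weight_mul_ite (R : F.Universe) :
    ∑' x : F.obj (Fin n), (F.weight x : ℝ≥0∞) * (if (⟨n, x⟩ : F.Universe) = R then 1 else 0)
      = if n = R.1 then (F.weight R.2 : ℝ≥0∞) else 0 := by
  obtain ⟨r, R⟩ := R
  split_ifs with hn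
  · subst hn
    simp [Sigma.mk.injEq]
  · simp [hn]

theorem remainderLaw_apply [IsEmpty (G.obj (Fin 0))] (hn : 0 < n)
    (hpos : 0 < coeff n (F.comp G).egf) (R : (F.deriv.comp G).Universe) (hR : 2 * R.1 < n) :
    F.remainderLaw G n hn hpos R
      = n.choose R.1 * (G.mass (n - R.1) * (F.deriv.comp G).weight R.2)
        / ((F.comp G).mass n : ℝ≥0∞) := by
  classical
  have hr : R.1 ≤ n := by omega
  calc F.remainderLaw G n hn hpos R
      = (∑' S : (F.comp G).obj (Fin n), ∑' Q : S.1.1, ((F.comp G).weight S : ℝ≥0∞) *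
          if F.remainder G S Q = R then 1 else 0) / (F.comp G).mass n := by
        rw [remainderLaw, PMF.bind_apply, div_eq_mul_inv, ← ENNReal.tsum_mul_right]
        refine tsum_congr fun S => ?_
        rw [sample, PMF.normalize_apply, ← coe_mass, F.map_remainder_apply G S _ R hR,
          ENNReal.tsum_mul_left]
        ring
    _ = _ := by
        rw [F.tsum_remainder G fun R' => if R' = R then 1 else 0]
        simp only [tsum_weight_mul_ite]
        rw [Finset.sum_eq_single (n - R.1, R.1)]
        · rw [if_pos rfl, Nat.choose_symm hr, nsmul_eq_mul]
        · intro ij hij hne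
          rw [if_neg, mul_zero, smul_zero]
          intro hr'
          rw [Finset.HasAntidiagonal.mem_antidiagonal] at hij
          exact hne (Prod.ext (by omega) hr')
        · exact fun hmem => absurd (Finset.HasAntidiagonal.mem_antidiagonal.2
            (Nat.sub_add_cancel hr)) hmem

theorem toReal_remainderLaw_apply [IsEmpty (G.obj (Fin 0))] (hn : 0 < n)
    (hpos : 0 < coeff n (F.comp G).egf) (R : (F.deriv.comp G).Universe) (hR : 2 * R.1 < n) :
    (F.remainderLaw G n hn hpos R).toReal
      = (F.deriv.comp G).weight R.2 / R.1.factorial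
        * (coeff (n - R.1) G.egf / coeff n (F.comp G).egf) := by
  have hr : R.1 ≤ n := by omega
  have hchoose : (n.choose R.1 : ℝ) ≠ 0 := mod_cast (Nat.choose_pos hr).ne'
  rw [F.remainderLaw_apply G hn hpos R hR]
  simp only [ENNReal.toReal_mul, ENNReal.toReal_div, ENNReal.toReal_natCast, ENNReal.coe_toReal]
  rw [coe_mass_eq_factorial_mul_coeff_egf, coe_mass_eq_factorial_mul_coeff_egf,
    ← Nat.choose_mul_factorial_mul_factorial hr]
  push_cast
  field_simp

end RemainderLaw

theorem inclusion_injective (D a : ℕ) : Function.Injective (F.inclusion G D a) := by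
  rintro ⟨r, π, ⟨x, hx⟩, y⟩ ⟨r', π', ⟨x', hx'⟩, y'⟩ h
  simp only [inclusion] at h
  cases h
  rfl

theorem toReal_boltzmann_apply {y : ℝ≥0} (h0 : F.value y ≠ 0) (h : F.value y ≠ ∞)
    (x : F.Universe) :
    (F.boltzmann y h0 h x).toReal
      = F.weight x.2 / x.1.factorial * (y ^ x.1 / (F.value y).toReal) := by
  have happly : F.boltzmann y h0 h x = F.boltzmannWeight y x * (F.value y)⁻¹ :=
    PMF.normalize_apply _ _ _
  rw [happly, boltzmannWeight, ENNReal.toReal_mul, ENNReal.toReal_inv, ENNReal.coe_toReal]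
  push_cast
  ring

end WeightedSpecies

section TotalVariation

variable {α : Type}

theorem map_apply_of_injective {β : Type*} (p : PMF α) {f : α → β} (hf : f.Injective) (x : α) :
    p.map f (f x) = p x := by
  rw [PMF.map_apply, tsum_eq_single x, if_pos rfl]
  exact fun y hy => if_neg fun h => hy (hf h).symm

theorem hasSum_toReal_pmf (p : PMF α) : HasSum (fun x => (p x).toReal) 1 := by
  have h := ENNReal.hasSum_toReal p.tsum_coe_ne_top
  rwa [← ENNReal.tsum_toReal_eq p.apply_ne_top, p.tsum_coe, ENNReal.toReal_one] at h

theorem hasSum_toReal_toOuterMeasure (p : PMF α) (E : Set α) :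
    HasSum (E.indicator fun x => (p x).toReal) (p.toOuterMeasure E).toReal := by
  have hE : (p.toOuterMeasure E).toReal = ∑' x, E.indicator (fun x => (p x).toReal) x := by
    have hne (x : α) : E.indicator p x ≠ ∞ :=
      ((E.indicator_le_self p x).trans_lt (p.apply_lt_top x)).ne
    rw [p.toOuterMeasure_apply, ENNReal.tsum_toReal_eq hne]
    exact tsum_congr fun x => by by_cases hx : x ∈ E <;> simp [hx]
  rw [hE]
  exact ((hasSum_toReal_pmf p).summable.indicator E).hasSum

theorem toReal_toOuterMeasure_compl (p : PMF α) (E : Set α) :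
    (p.toOuterMeasure Eᶜ).toReal = 1 - (p.toOuterMeasure E).toReal := by
  refine eq_sub_of_add_eq' (HasSum.unique ?_ (hasSum_toReal_pmf p))
  refine ((hasSum_toReal_toOuterMeasure p E).add
    (hasSum_toReal_toOuterMeasure p Eᶜ)).congr_fun fun x => ?_
  by_cases hx : x ∈ E <;> simp [hx]

theorem summable_max_toReal_sub_zero (p q : PMF α) :
    Summable fun x => max ((q x).toReal - (p x).toReal) 0 :=
  .of_nonneg_of_le (fun _ => le_max_right _ _)
    (fun _ => max_le (sub_le_self _ ENNReal.toReal_nonneg) ENNReal.toReal_nonneg)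
    (hasSum_toReal_pmf q).summable

theorem dTV_le_tsum_max (p q : PMF α) :
    dTV p q ≤ ∑' x, max ((q x).toReal - (p x).toReal) 0 := by
  have hle (E : Set α) : (q.toOuterMeasure E).toReal - (p.toOuterMeasure E).toReal
      ≤ ∑' x, max ((q x).toReal - (p x).toReal) 0 := by
    refine hasSum_le (fun x => ?_) ((hasSum_toReal_toOuterMeasure q E).sub
      (hasSum_toReal_toOuterMeasure p E)) (summable_max_toReal_sub_zero p q).hasSum
    by_cases hx : x ∈ E <;> simp [hx]
  refine ciSup_le fun E => abs_le.2 ⟨by linarith [hle E], ?_⟩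
  have hcompl := hle Eᶜ
  rw [toReal_toOuterMeasure_compl, toReal_toOuterMeasure_compl] at hcompl
  linarith

/-- Scheffé's lemma for discrete distributions. -/
theorem tendsto_dTV_zero {ι : Type*} {l : Filter ι} {p : ι → PMF α} {q : PMF α}
    (h : ∀ x ∈ q.support, Tendsto (fun i => (p i x).toReal) l (𝓝 (q x).toReal)) :
    Tendsto (fun i => dTV (p i) q) l (𝓝 0) := by
  have hterm (x : α) : Tendsto (fun i => max ((q x).toReal - (p i x).toReal) 0) l (𝓝 0) := by
    by_cases hx : x ∈ q.support
    · simpa using ((h x hx).const_sub (q x).toReal).max (tendsto_const_nhds (x := (0 : ℝ)))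
    · have hqx : q x = 0 := (PMF.apply_eq_zero_iff q x).2 hx
      simp [hqx, tendsto_const_nhds]
  have hsum : Tendsto (fun i => ∑' x, max ((q x).toReal - (p i x).toReal) 0) l (𝓝 0) := by
    suffices hdom : ∀ i x, ‖max ((q x).toReal - (p i x).toReal) 0‖ ≤ (q x).toReal by
      simpa only [tsum_zero] using tendsto_tsum_of_dominated_convergence
        (hasSum_toReal_pmf q).summable hterm (.of_forall hdom)
    intro i x
    rw [Real.norm_of_nonneg (le_max_right _ _)]
    exact max_le (sub_le_self _ ENNReal.toReal_nonneg) ENNReal.toReal_nonneg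
  exact squeeze_zero (fun i => Real.iSup_nonneg fun E => abs_nonneg _)
    (fun i => dTV_le_tsum_max (p i) q) hsum

end TotalVariation

section Lattice

theorem hasSum_coeff_X_pow_mul_iff {R : Type*} [Semiring R] [TopologicalSpace R]
    (m : ℕ) {u : R⟦X⟧} {A : R} :
    HasSum (fun n => coeff n (X ^ m * u)) A ↔ HasSum (fun n => coeff n u) A := by
  rw [← (add_left_injective m).hasSum_iff fun n hn => ?_]
  · simp only [Function.comp_def, coeff_X_pow_mul]
  · rw [coeff_X_pow_mul', if_neg fun h => hn ⟨n - m, Nat.sub_add_cancel h⟩]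

theorem hasSum_coeff_expand_iff {R : Type*} [CommRing R] [TopologicalSpace R]
    {d : ℕ} (hd : d ≠ 0) {u : R⟦X⟧} {A : R} :
    HasSum (fun n => coeff n (expand d hd u)) A ↔ HasSum (fun n => coeff n u) A := by
  rw [← (mul_right_injective₀ hd).hasSum_iff fun n hn => ?_]
  · simp only [Function.comp_def, coeff_expand_mul]
  · exact coeff_expand_of_not_dvd d hd u fun ⟨k, hk⟩ => hn ⟨k, hk.symm⟩

section

variable {R : Type*} [CommRing R] {d m : ℕ} (hd : d ≠ 0) (p : R⟦X⟧)

theorem coeff_X_pow_mul_expand_pow {k b s : ℕ} (h : m * k = b + d * s) (t : ℕ) :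
    coeff (b + d * t) ((X ^ m * expand d hd p) ^ k) = coeff t (X ^ s * p ^ k) := by
  have hfactor : (X ^ m * expand d hd p) ^ k = X ^ b * expand d hd (X ^ s * p ^ k) := by
    rw [mul_pow, ← pow_mul, h, map_mul, map_pow, map_pow, expand_X, pow_add, pow_mul, mul_assoc]
  rw [hfactor, add_comm, coeff_X_pow_mul, coeff_expand_mul]

variable {p} in
theorem exists_eq_add_mul_of_coeff_ne_zero {k n : ℕ}
    (h : coeff n ((X ^ m * expand d hd p) ^ k) ≠ 0) : ∃ u, n = m * k + d * u := by
  rw [mul_pow, ← pow_mul, ← map_pow, coeff_X_pow_mul'] at h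
  obtain ⟨hle, hcoeff⟩ := ite_ne_right_iff.1 h
  obtain ⟨u, hu⟩ := not_imp_comm.1 (coeff_expand_of_not_dvd d hd _) hcoeff
  exact ⟨u, by omega⟩

end

theorem mul_eq_add_mul_div_of_modEq {d m a k : ℕ} (ha : a < d / m.gcd d)
    (hk : k ≡ a [MOD d / m.gcd d]) :
    m * k = a * m + d * (m / m.gcd d * (k / (d / m.gcd d))) := by
  set D := d / m.gcd d with hD
  have hmD : m * D = d * (m / m.gcd d) := by
    rw [hD, ← Nat.mul_div_assoc _ (m.gcd_dvd_right d), ← Nat.mul_div_assoc _ (m.gcd_dvd_left d),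
      mul_comm]
  calc m * k = m * (a + D * (k / D)) := by
        rw [← Nat.mod_eq_of_modEq hk ha, Nat.mod_add_div]
    _ = a * m + m * D * (k / D) := by ring
    _ = a * m + d * (m / m.gcd d * (k / D)) := by rw [hmD]; ring

theorem coeff_X_pow_mul_expand_pow_eq_zero {R : Type*} [CommRing R] {d m a k : ℕ} (hd : d ≠ 0)
    (p : R⟦X⟧) (hk : ¬ k ≡ a [MOD d / m.gcd d]) (t : ℕ) :
    coeff (a * m + d * t) ((X ^ m * expand d hd p) ^ k) = 0 := by
  by_contra hne
  obtain ⟨u, hu⟩ := exists_eq_add_mul_of_coeff_ne_zero hd hne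
  have hmod : m * k ≡ m * a [MOD d] := by
    simpa [Nat.ModEq, mul_comm a m] using congrArg (· % d) hu.symm
  rw [Nat.gcd_comm] at hk
  exact hk (hmod.cancel_left_div_gcd (Nat.pos_of_ne_zero hd))

/-- The weights `ρ ^ n * [z ^ n] (z ^ m * g)` of the indices `n = m + d * t`, as a series in `t`.
If `g` is supported on multiples of `d`, these are all non-zero coefficients of `z ^ m * g`,
rescaled to radius of convergence one. -/
def latticeDensity (d m : ℕ) (ρ : ℝ) (g : ℝ⟦X⟧) : ℝ⟦X⟧ :=
  mk fun t => ρ ^ (m + d * t) * coeff (d * t) g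

theorem coeff_latticeDensity (d m : ℕ) (ρ : ℝ) (g : ℝ⟦X⟧) (t : ℕ) :
    coeff t (latticeDensity d m ρ g) = ρ ^ (m + d * t) * coeff (d * t) g :=
  coeff_mk _ _

theorem rescale_X_pow_mul_eq_expand_latticeDensity {d : ℕ} (hd : d ≠ 0) (m : ℕ) (ρ : ℝ) {g : ℝ⟦X⟧}
    (hg : ∀ n, ¬ d ∣ n → coeff n g = 0) :
    rescale ρ (X ^ m * g) = X ^ m * expand d hd (latticeDensity d m ρ g) := by
  ext n
  rw [coeff_rescale, coeff_X_pow_mul', coeff_X_pow_mul']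
  split_ifs with hmn
  · obtain ⟨i, rfl⟩ := Nat.exists_eq_add_of_le hmn
    rw [Nat.add_sub_cancel_left]
    by_cases hdi : d ∣ i
    · obtain ⟨t, rfl⟩ := hdi
      rw [coeff_expand_mul, coeff_latticeDensity]
    · rw [hg i hdi, mul_zero, coeff_expand_of_not_dvd d hd _ hdi]
  · rw [mul_zero]

theorem coeff_latticeDensity_mul_self {d : ℕ} (hd : d ≠ 0) (m : ℕ) (ρ : ℝ) {g : ℝ⟦X⟧}
    (hg : ∀ n, ¬ d ∣ n → coeff n g = 0) (t : ℕ) :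
    coeff t (latticeDensity d m ρ g * latticeDensity d m ρ g)
      = ρ ^ m * (ρ ^ (m + d * t) * coeff (d * t) (g * g)) := by
  have hsq := coeff_X_pow_mul_expand_pow hd (latticeDensity d m ρ g) (m := m) (k := 2)
    (b := m * 2) (s := 0) rfl t
  rw [← rescale_X_pow_mul_eq_expand_latticeDensity hd m ρ hg, ← map_pow, coeff_rescale, mul_pow,
    ← pow_mul, add_comm, coeff_X_pow_mul, pow_zero, one_mul, sq, sq] at hsq
  rw [← hsq]
  ring

theorem summable_mul_pow_pred {c : ℕ → ℝ} (hc : ∀ k, 0 ≤ c k) {x y : ℝ} (hy : 0 ≤ y) (hyx : y < x)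
    (h : Summable fun k => c k * x ^ k) : Summable fun k => c k * (k * y ^ (k - 1)) := by
  refine .of_nonneg_of_le (fun k => mul_nonneg (hc k) (by positivity)) (fun k => ?_)
    (h.mul_left (x - y)⁻¹)
  have hxy : 0 < x - y := sub_pos.2 hyx
  have hbound : (k : ℝ) * y ^ (k - 1) * (x - y) ≤ x ^ k :=
    calc (k : ℝ) * y ^ (k - 1) * (x - y)
        = (∑ i ∈ Finset.range k, y ^ i * y ^ (k - 1 - i)) * (x - y) := by rw [geom_sum₂_self]
      _ ≤ (∑ i ∈ Finset.range k, x ^ i * y ^ (k - 1 - i)) * (x - y) := by gcongr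
      _ = x ^ k - y ^ k := geom_sum₂_mul x y k
      _ ≤ x ^ k := sub_le_self _ (by positivity)
  calc c k * (k * y ^ (k - 1)) ≤ c k * ((x - y)⁻¹ * x ^ k) := by
        rw [inv_mul_eq_div]
        exact mul_le_mul_of_nonneg_left ((le_div_iff₀ hxy).2 hbound) (hc k)
    _ = (x - y)⁻¹ * (c k * x ^ k) := by ring

theorem exists_summable_of_lt_radiusOfConvergence {f : ℝ⟦X⟧} {y : ℝ}
    (h : ENNReal.ofReal y < radiusOfConvergence f) :
    ∃ x : ℝ≥0, y < x ∧ Summable fun k => |coeff k f| * (x : ℝ) ^ k := by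
  obtain ⟨r, hyr, hr⟩ := ENNReal.lt_iff_exists_nnreal_btwn.1 h
  refine ⟨r, (Real.le_coe_toNNReal y).trans_lt (ENNReal.coe_lt_coe.1 hyr), ?_⟩
  simpa [FormalMultilinearSeries.ofScalars_norm] using
    FormalMultilinearSeries.summable_norm_mul_pow _ hr

end Lattice

namespace IsSubexponential

variable {d : ℕ} {ρ : ℝ≥0} {g : ℝ⟦X⟧}

theorem span_ne_zero (hg : IsSubexponential d ρ g) : d ≠ 0 :=
  Nat.one_le_iff_ne_zero.1 hg.one_le

theorem hasSum_coeff_rescale_X_pow_mul (hg : IsSubexponential d ρ g) (m : ℕ) :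
    HasSum (fun n => coeff n (rescale (ρ : ℝ) (X ^ m * g)))
      (ρ ^ m * ∑' n, coeff n g * (ρ : ℝ) ^ n) := by
  have hfactor : rescale (ρ : ℝ) (X ^ m * g) = X ^ m * (C ((ρ : ℝ) ^ m) * rescale (ρ : ℝ) g) := by
    rw [map_mul, map_pow, rescale_X, mul_pow, map_pow]
    ring
  rw [hfactor, hasSum_coeff_X_pow_mul_iff]
  refine (hg.summable.hasSum.mul_left _).congr_fun fun n => ?_
  rw [coeff_C_mul, coeff_rescale, mul_comm (coeff n g)]

theorem isSubexponentialDensity_latticeDensity (hg : IsSubexponential d ρ g) (m : ℕ) :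
    IsSubexponentialDensity (latticeDensity d m ρ g) (ρ ^ m * ∑' n, coeff n g * (ρ : ℝ) ^ n) := by
  have hρ : (0 : ℝ) < ρ := hg.radius_pos
  refine ⟨fun n => ?_, ?_, ?_, ?_⟩
  · rw [coeff_latticeDensity]
    exact mul_nonneg (by positivity) (hg.nonneg _)
  · rw [← hasSum_coeff_expand_iff hg.span_ne_zero, ← hasSum_coeff_X_pow_mul_iff m,
      ← rescale_X_pow_mul_eq_expand_latticeDensity hg.span_ne_zero m ρ hg.support]
    exact hg.hasSum_coeff_rescale_X_pow_mul m
  · have hratio := hg.ratio.div_const ((ρ : ℝ) ^ d)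
    rw [div_self (by positivity)] at hratio
    refine hratio.congr fun n => ?_
    rw [coeff_latticeDensity, coeff_latticeDensity, mul_add, mul_one, ← add_assoc, pow_add _ _ d,
      mul_assoc, mul_div_mul_left _ _ (by positivity), div_div, mul_comm ((ρ : ℝ) ^ d)]
  · have hconv := hg.convolution.const_mul ((ρ : ℝ) ^ m)
    rw [mul_left_comm] at hconv
    refine hconv.congr fun n => ?_
    rw [coeff_latticeDensity_mul_self hg.span_ne_zero m ρ hg.support, coeff_latticeDensity,
      coeff_mul, mul_div_assoc, mul_div_mul_left _ _ (by positivity)]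

end IsSubexponential

theorem exists_forall_of_eventually_add_mul {d b : ℕ} (hd : d ≠ 0) {q : ℕ → Prop}
    (h : ∀ᶠ t in atTop, q (b + d * t)) : ∃ N, ∀ n, N ≤ n → n ≡ b [MOD d] → q n := by
  obtain ⟨T, hT⟩ := eventually_atTop.1 h
  refine ⟨b + d * T, fun n hn hmod => ?_⟩
  obtain ⟨t, ht⟩ := (Nat.modEq_iff_dvd' (le_of_add_le_left hn)).1 hmod.symm
  obtain rfl : n = b + d * t := by omega
  exact hT t (Nat.le_of_mul_le_mul_left (Nat.le_of_add_le_add_left hn) (Nat.pos_of_ne_zero hd))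

namespace WeightedSpecies

variable (F G : WeightedSpecies)

theorem exists_summable_coeff_egf_restrict {y : ℝ}
    (hF : ENNReal.ofReal y < radiusOfConvergence F.egf) (D a : ℕ) :
    ∃ x : ℝ≥0, y < x ∧ Summable fun k => coeff k (F.restrict D a).egf * (x : ℝ) ^ k := by
  obtain ⟨x, hyx, hx⟩ := exists_summable_of_lt_radiusOfConvergence hF
  refine ⟨x, hyx, .of_nonneg_of_le (fun k => mul_nonneg (coeff_egf_nonneg _ k) (by positivity))
    (fun k => mul_le_mul_of_nonneg_right ?_ (by positivity)) hx⟩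
  rw [coeff_egf_restrict]
  split_ifs
  exacts [le_abs_self _, abs_nonneg _]

variable {F} in
theorem tsum_coeff_egf_mul_pow_pred_pos (hF : ¬ ∃ c : ℝ, F.egf = C c) {P : ℝ} (hP : 0 < P)
    (hsum : Summable fun k => coeff k F.egf * (k * P ^ (k - 1))) :
    0 < ∑' k, coeff k F.egf * (k * P ^ (k - 1)) := by
  obtain ⟨k, hk⟩ : ∃ k, coeff (k + 1) F.egf ≠ 0 := by
    contrapose! hF
    refine ⟨coeff 0 F.egf, PowerSeries.ext fun n => ?_⟩
    cases n <;> simp [hF, coeff_C]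
  have hpos : 0 < coeff (k + 1) F.egf := (coeff_egf_nonneg F _).lt_of_ne' hk
  exact hsum.tsum_pos (fun i => mul_nonneg (coeff_egf_nonneg F i) (by positivity)) (k + 1)
    (by positivity)

variable {F G} {d m a : ℕ} {hd : d ≠ 0} {ρ : ℝ≥0} {p : ℝ⟦X⟧}

theorem hasSum_coeff_rescale_egf_comp_lattice [IsEmpty (G.obj (Fin 0))]
    (hGp : rescale (ρ : ℝ) G.egf = X ^ m * expand d hd p) (ha : a < d / m.gcd d) (t : ℕ) :
    HasSum (fun k => coeff k (F.restrict (d / m.gcd d) a).egf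
        * coeff t (X ^ (m / m.gcd d * (k / (d / m.gcd d))) * p ^ k))
      (coeff (a * m + d * t) (rescale (ρ : ℝ) (F.comp G).egf)) := by
  refine (F.hasSum_coeff_rescale_egf_comp G ρ (a * m + d * t)).congr_fun fun k => ?_
  rw [coeff_egf_restrict, hGp]
  split_ifs with hk
  · rw [coeff_X_pow_mul_expand_pow hd p (mul_eq_add_mul_div_of_modEq ha hk)]
  · rw [coeff_X_pow_mul_expand_pow_eq_zero hd p hk, mul_zero, zero_mul]

theorem tendsto_coeff_rescale_egf_comp_div [IsEmpty (G.obj (Fin 0))] {P x : ℝ}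
    (hp : IsSubexponentialDensity p P)
    (hGp : rescale (ρ : ℝ) G.egf = X ^ m * expand d hd p) (ha : a < d / m.gcd d) (hx : P < x)
    (hsum : Summable fun k => coeff k (F.restrict (d / m.gcd d) a).egf * x ^ k) :
    Tendsto (fun t => coeff (a * m + d * t) (rescale (ρ : ℝ) (F.comp G).egf) / coeff t p) atTop
      (𝓝 (∑' k, coeff k (F.restrict (d / m.gcd d) a).egf * (k * P ^ (k - 1)))) := by
  refine (hp.tendsto_tsum_coeff_pow_div (coeff_egf_nonneg _)
    (fun k => Nat.mul_le_mul_left (m / m.gcd d) (Nat.div_le_self k (d / m.gcd d))) hx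
    hsum).congr fun t => ?_
  rw [(hasSum_coeff_rescale_egf_comp_lattice hGp ha t).tsum_eq]

theorem eventually_coeff_pos_of_tendsto {H : ℝ⟦X⟧} (hH : ∀ n, 0 ≤ coeff n H) {V : ℝ} (hV : 0 < V)
    {b : ℕ}
    (hlim : Tendsto (fun t => coeff (b + d * t) (rescale (ρ : ℝ) H) / coeff t p) atTop (𝓝 V)) :
    ∀ᶠ t in atTop, 0 < coeff (b + d * t) H := by
  filter_upwards [hlim.eventually_const_lt hV] with t ht
  refine (hH _).lt_of_ne' fun hzero => ht.ne' ?_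
  rw [coeff_rescale, hzero, mul_zero, zero_div]

theorem tendsto_coeff_egf_sub_div {P V : ℝ} {H : ℝ⟦X⟧} (hp : IsSubexponentialDensity p P)
    (hGp : rescale (ρ : ℝ) G.egf = X ^ m * expand d hd p) (hρ : 0 < ρ) {b r j : ℕ}
    (hr : r + m = b + d * j) (hV : V ≠ 0)
    (hlim : Tendsto (fun t => coeff (b + d * t) (rescale (ρ : ℝ) H) / coeff t p) atTop (𝓝 V)) :
    Tendsto (fun t => coeff (b + d * t - r) G.egf / coeff (b + d * t) H) atTop
      (𝓝 (ρ ^ r / V)) := by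
  have hquot := ((hp.tendsto_coeff_sub_div j).div hlim hV).const_mul ((ρ : ℝ) ^ r)
  rw [mul_one_div] at hquot
  refine hquot.congr' ?_
  filter_upwards [hp.eventually_pos, eventually_ge_atTop j] with t hpos hjt
  obtain ⟨u, rfl⟩ := Nat.exists_eq_add_of_le hjt
  have hindex : b + d * (j + u) = r + (m + d * u) := by rw [mul_add]; omega
  have hcoeff : (ρ : ℝ) ^ (m + d * u) * coeff (m + d * u) G.egf = coeff u p := by
    rw [← coeff_rescale, hGp, add_comm, coeff_X_pow_mul, coeff_expand_mul]
  rw [Pi.div_apply, hindex, Nat.add_sub_cancel_left, Nat.add_sub_cancel_left,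
    div_div_div_cancel_right₀ hpos.ne', coeff_rescale, ← hcoeff, pow_add _ r]
  have : (ρ : ℝ) ≠ 0 := mod_cast hρ.ne'
  field_simp

theorem exists_size_add_eq_of_weight_ne_zero [IsEmpty (G.obj (Fin 0))]
    (hGp : rescale (ρ : ℝ) G.egf = X ^ m * expand d hd p) (hρ : 0 < ρ) (ha : a < d / m.gcd d)
    (R : ((F.restrict (d / m.gcd d) a).deriv.comp G).Universe)
    (hR : ((F.restrict (d / m.gcd d) a).deriv.comp G).weight R.2 ≠ 0) :
    ∃ j, R.1 + m = a * m + d * j := by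
  have hne : coeff R.1 (rescale (ρ : ℝ) G.egf ^ Nat.card R.2.1.1) ≠ 0 := by
    rw [← map_pow, coeff_rescale]
    exact mul_ne_zero (by positivity) (coeff_egf_pow_ne_zero_of_weight_ne_zero _ _ hR)
  rw [hGp] at hne
  obtain ⟨u, hu⟩ := exists_eq_add_mul_of_coeff_ne_zero hd hne
  have hcard : Nat.card R.2.1.1 + 1 ≡ a [MOD d / m.gcd d] := by
    rw [← Finite.card_option]
    exact R.2.2.1.2
  have hmk := mul_eq_add_mul_div_of_modEq ha hcard
  exact ⟨m / m.gcd d * ((Nat.card R.2.1.1 + 1) / (d / m.gcd d)) + u, by rw [mul_add]; lia⟩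

theorem tendsto_dTV_remainderLaw [IsEmpty (G.obj (Fin 0))] {P : ℝ}
    (hp : IsSubexponentialDensity p P)
    (hGp : rescale (ρ : ℝ) G.egf = X ^ m * expand d hd p) (hρ : 0 < ρ) (ha : a < d / m.gcd d)
    (h0 : ((F.restrict (d / m.gcd d) a).deriv.comp G).value ρ ≠ 0)
    (h1 : ((F.restrict (d / m.gcd d) a).deriv.comp G).value ρ ≠ ∞)
    (hlim : Tendsto (fun t => coeff (a * m + d * t) (rescale (ρ : ℝ) (F.comp G).egf) / coeff t p)
      atTop (𝓝 (((F.restrict (d / m.gcd d) a).deriv.comp G).value ρ).toReal)) :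
    Tendsto (fun t : {t : ℕ // 0 < a * m + d * t ∧ 0 < coeff (a * m + d * t) (F.comp G).egf} =>
        dTV (F.remainderLaw G (a * m + d * t) t.2.1 t.2.2)
          ((((F.restrict (d / m.gcd d) a).deriv.comp G).boltzmann ρ h0 h1).map
            (F.inclusion G (d / m.gcd d) a)))
      (comap Subtype.val atTop) (𝓝 0) := by
  refine tendsto_dTV_zero fun R hR => ?_
  obtain ⟨R, hR', rfl⟩ := (PMF.mem_support_map_iff _ _ _).1 hR
  have hboltzmann := toReal_boltzmann_apply _ h0 h1 R
  have hweight : ((F.restrict (d / m.gcd d) a).deriv.comp G).weight R.2 ≠ 0 := by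
    have hne := ENNReal.toReal_ne_zero.2 ⟨hR', PMF.apply_ne_top _ R⟩
    rw [hboltzmann] at hne
    exact fun h => hne (by rw [h, NNReal.coe_zero, zero_div, zero_mul])
  obtain ⟨j, hj⟩ := exists_size_add_eq_of_weight_ne_zero hGp hρ ha R hweight
  rw [map_apply_of_injective _ (F.inclusion_injective G _ a), hboltzmann]
  have hratio := tendsto_coeff_egf_sub_div hp hGp hρ hj (ENNReal.toReal_ne_zero.2 ⟨h0, h1⟩) hlim
  refine ((hratio.const_mul _).comp tendsto_comap).congr' ?_
  filter_upwards [preimage_mem_comap (eventually_gt_atTop (2 * R.1))] with t ht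
  have hsize : 2 * R.1 < a * m + d * t := by
    have := Nat.le_mul_of_pos_left t.1 (Nat.pos_of_ne_zero hd)
    exact (Set.mem_preimage.1 ht).trans_le (by omega)
  exact (F.toReal_remainderLaw_apply G t.2.1 t.2.2 (F.inclusion G _ a R) hsize).symm

end WeightedSpecies

end

open WeightedSpecies Filter in
theorem theorem3p4 (F G : WeightedSpecies) (hG : IsEmpty (G.obj (Fin 0)))
    (d m : ℕ) (hm : m < d) (ρ : NNReal) (g : PowerSeries ℝ)
    (hg : IsSubexponential d ρ g) (hGg : G.egf = PowerSeries.X ^ m * g)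
    (hF : G.value ρ < radiusOfConvergence F.egf)
    (D : ℕ) (hD : D = d / Nat.gcd m d) (a : ℕ) (ha : a < D)
    (hFa : ¬ ∃ c : ℝ, (F.restrict D a).egf = PowerSeries.C c) :
    ∃ (h0 : ((F.restrict D a).deriv.comp G).value ρ ≠ 0)
      (h1 : ((F.restrict D a).deriv.comp G).value ρ ≠ ⊤),
      ∀ ε : ℝ, 0 < ε → ∃ N : ℕ, ∀ n : ℕ, N ≤ n → n ≡ a * m [MOD d] →
        ∃ (hn : 0 < n) (hpos : 0 < PowerSeries.coeff n (F.comp G).egf),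
          dTV (F.remainderLaw G n hn hpos)
            ((((F.restrict D a).deriv.comp G).boltzmann ρ h0 h1).map (F.inclusion G D a)) < ε := by
  subst hD
  have hd : d ≠ 0 := hg.span_ne_zero
  have hp := hg.isSubexponentialDensity_latticeDensity m
  have hP := hg.hasSum_coeff_rescale_X_pow_mul m
  have hGp := rescale_X_pow_mul_eq_expand_latticeDensity hd m ρ hg.support
  rw [← hGg] at hP hGp
  rw [G.value_eq_ofReal hP] at hF
  obtain ⟨x, hPx, hx⟩ := F.exists_summable_coeff_egf_restrict hF (d / m.gcd d) a
  have hV := summable_mul_pow_pred (coeff_egf_nonneg _) hp.sum_pos.le hPx hx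
  have hVpos := tsum_coeff_egf_mul_pow_pred_pos hFa hp.sum_pos hV
  have hvalue := value_deriv_comp_eq_ofReal _ G hP hV.hasSum
  have hlim := tendsto_coeff_rescale_egf_comp_div hp hGp ha hPx hx
  have hcoeff := eventually_coeff_pos_of_tendsto (coeff_egf_nonneg _) hVpos hlim
  rw [← ENNReal.toReal_ofReal hVpos.le, ← hvalue] at hlim
  have h0 : ((F.restrict (d / m.gcd d) a).deriv.comp G).value ρ ≠ 0 := by simpa [hvalue]
  have h1 : ((F.restrict (d / m.gcd d) a).deriv.comp G).value ρ ≠ ⊤ := by simp [hvalue]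
  refine ⟨h0, h1, fun ε hε => exists_forall_of_eventually_add_mul hd ?_⟩
  have hdTV := tendsto_dTV_remainderLaw hp hGp hg.radius_pos ha h0 h1 hlim
  filter_upwards [eventually_comap.1 (hdTV.eventually_lt_const hε), eventually_gt_atTop 0,
    hcoeff] with t hlt ht hpos
  exact ⟨by positivity, hpos, hlt ⟨t, by positivity, hpos⟩ rfl⟩
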